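/- Let $n\ge 1$, let $\mathbb B^n(c;r)=\{z\in\mathbb C^n:\|z-c\|<r\}$ and $\mathbb B^n=\mathbb B^n(0;1)$, where $\|\cdot\|$ is the Hermitian norm. For a domain (nonempty connected open set) $\Omega\subset\mathbb C^n$ and $q\in\Omega$, let $\mathcal F(q,\Omega)$ be the set of injective holomorphic maps $f:\Omega\to\mathbb B^n$ with $f(q)=0$. The squeezing function of $\Omega$ is $$\sigma_\Omega(q)=\sup\{r>0:\ \mathbb B^n(0;r)\subset f(\Omega)\text{ for some }f\in\mathcal F(q,\Omega)\},$$ with $\sup\emptyset=0$. A boundary point $p\in\partial\Omega$ is called spherically-extreme if (1) $\partial\Omega$ is $\mathcal C^2$ smooth near $p$, that is, there are an open neighborhood $U$ of $p$ and a $\mathcal C^2$ function $\rho:U\to\mathbb R$ with $d\rho\neq 0$ at every point of $U$ and $\Omega\cap U=\{z\in U:\rho(z)<0\}$; and (2) there are $c\in\mathbb C^n$ and $R>0$ such that $\Omega\subset\mathbb B^n(c;R)$ and $p\in\partial\mathbb B^n(c;R)$. Theorem. If $\Omega\subset\mathbb C^n$ is a domain and $p\in\partial\Omega$ is a spherically-extreme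 boundary point of $\Omega$, then $$\lim_{\Omega\ni q\to p}\sigma_\Omega(q)=1,$$ where $q$ tends to $p$ within $\Omega$ without any restriction on the manner of approach. -/

import Mathlib

open Filter Topology

/-- The complex Euclidean space `ℂⁿ` with its Hermitian norm. -/
abbrev Cn (n : ℕ) : Type := EuclideanSpace ℂ (Fin n)

/-- A domain in `ℂⁿ`: an open connected (in particular nonempty) subset. -/
def IsDomainIn {n : ℕ} (Ω : Set (Cn n)) : Prop :=
  IsOpen Ω ∧ IsConnected Ω

/-- The family `𝓕(q, Ω)` of injective holomorphic maps `f : Ω → 𝔹ⁿ` into the open unit ball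
with `f q = 0`. Only the values of `f` on `Ω` matter. -/
def squeezingMaps {n : ℕ} (Ω : Set (Cn n)) (q : Cn n) : Set (Cn n → Cn n) :=
  {f | DifferentiableOn ℂ f Ω ∧ Set.InjOn f Ω ∧ Set.MapsTo f Ω (Metric.ball 0 1) ∧ f q = 0}

/-- The squeezing function `σ_Ω`: the supremum of the radii `r > 0` such that the ball of radius
`r` about `0` lies in `f(Ω)` for some `f ∈ 𝓕(q, Ω)`. For `n ≥ 1` these radii are bounded by `1`,
so this is a genuine supremum; it is `0` if there is no such radius. -/
noncomputable def squeezingFunction {n : ℕ} (Ω : Set (Cn n)) (q : Cn n) : ℝ :=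
  sSup {r : ℝ | 0 < r ∧ ∃ f ∈ squeezingMaps Ω q, Metric.ball (0 : Cn n) r ⊆ f '' Ω}

/-- The boundary of `Ω` is `C²` smooth in an open neighborhood `U` of `p`: there is a `C²`
real-valued local defining function `ρ` on `U` with nowhere vanishing (real) differential. -/
def HasC2BoundaryNear {n : ℕ} (Ω : Set (Cn n)) (p : Cn n) : Prop :=
  ∃ (U : Set (Cn n)) (ρ : Cn n → ℝ), IsOpen U ∧ p ∈ U ∧ ContDiffOn ℝ 2 ρ U ∧
    (∀ z ∈ U, fderiv ℝ ρ z ≠ 0) ∧ Ω ∩ U = {z ∈ U | ρ z < 0}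

/-- `p` is a spherically-extreme boundary point of `Ω`: the boundary of `Ω` is `C²` smooth near
`p`, and `Ω` lies in an open ball whose boundary sphere passes through `p`. -/
def IsSphericallyExtreme {n : ℕ} (Ω : Set (Cn n)) (p : Cn n) : Prop :=
  p ∈ frontier Ω ∧ HasC2BoundaryNear Ω p ∧
    ∃ (c : Cn n) (R : ℝ), 0 < R ∧ Ω ⊆ Metric.ball c R ∧ p ∈ Metric.sphere c R

/-! At `p` the enclosing sphere forces second-order contact. The conormals of the boundary and of
the sphere agree, and on the tangent space the suitably scaled Hessian of the defining function `ρ`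
dominates that of the sphere (`exists_tangency`). Hence `ρ + K/2 ρ²`, with `K` large, has positive
definite real Hessian at `p` and is convex nearby. Every `q` near `p` is `b + δ e`, with `b` its
nearest boundary point and `e` the inner unit normal there. Near `b` the domain is trapped between
two small perturbations of the region `Re ⟨e, w - b⟩ > B(w - b, w - b)`, and all of it satisfies `Re
⟨e, w - b⟩ ≥ κ‖w - b‖²`. The constants do not depend on `b`, so the approach of `q` needs no
restriction.

Dilating by `δ` along `e` and by `√δ` across carries `e` to `q - b`; its inverse turns the domain
into a set `D` which, on a large ball, is almost `Re x₁ > L(x') + Re P(x')`, with `L` Hermitian and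
`P` a holomorphic quadratic form. The shear `x₁ - P(x')` followed by the Cayley transform would send
this model onto `|z₁|² + L(z') < 1`, a linear image of the ball, and `e` to `0`.

Far away, however, only `c‖x'‖² ≤ Re x₁` is known, and there the shear could destroy the bound on
the image. So `P(x')` is multiplied by `(1 + x₁/T)^(-s)`. For `T` large this is nearly `1` on
bounded sets; it vanishes at infinity; for `s` small it is nearly a real number in `[0, 1]`, so the
sheared coordinate nearly interpolates between two quantities of controlled real part. Injectivity
and the lower bound on the real part then hold on all of `D` (`exists_cayley_map`), and points with
large sheared coordinate land near `e`. -/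

/-! ### The damping factor on the right half plane. -/

/-- The damping factor `(1 + t) ^ (-s)`, used on the closed right half plane. -/
noncomputable def damping (s : ℝ) (t : ℂ) : ℂ := Complex.exp (-(s * Complex.log (1 + t)))

lemma damping_zero (s : ℝ) : damping s 0 = 1 := by simp [damping]

lemma one_add_mem_slitPlane {t : ℂ} (ht : 0 ≤ t.re) : 1 + t ∈ Complex.slitPlane := by
  left; simp; linarith

lemma one_add_re_le_norm (t : ℂ) : 1 + t.re ≤ ‖1 + t‖ := by
  have := Complex.re_le_norm (1 + t)
  simpa using this

lemma norm_damping (s : ℝ) (t : ℂ) : ‖damping s t‖ = Real.exp (-(s * Real.log ‖1 + t‖)) := by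
  simp [damping, Complex.norm_exp, Complex.log_re]

lemma log_norm_one_add_nonneg {t : ℂ} (ht : 0 ≤ t.re) : 0 ≤ Real.log ‖1 + t‖ :=
  Real.log_nonneg (by linarith [one_add_re_le_norm t])

lemma norm_damping_le_one {s : ℝ} (hs : 0 ≤ s) {t : ℂ} (ht : 0 ≤ t.re) : ‖damping s t‖ ≤ 1 := by
  rw [norm_damping, Real.exp_le_one_iff, neg_nonpos]
  exact mul_nonneg hs (log_norm_one_add_nonneg ht)

/-- The argument of `1 + t` is at most `π/2` in modulus, so that of the damping factor is at most
`sπ/2`: the factor is within `2s` of its own modulus, which serves as `θ`. -/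
lemma exists_norm_damping_sub_le {s : ℝ} (hs : 0 ≤ s) {t : ℂ} (ht : 0 ≤ t.re) :
    ∃ θ : ℝ, 0 ≤ θ ∧ θ ≤ 1 ∧ ‖damping s t - θ‖ ≤ 2 * s := by
  have hle := norm_damping_le_one hs ht
  refine ⟨‖damping s t‖, norm_nonneg _, hle, ?_⟩
  have h1 : damping s t = ‖damping s t‖ *
      Complex.exp (Complex.I * ((-(s * (Complex.log (1 + t)).im) : ℝ) : ℂ)) := by
    rw [norm_damping, Complex.ofReal_exp, ← Complex.exp_add, damping]
    congr 1
    apply Complex.ext <;> simp [Complex.log_re]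
  have harg : |(Complex.log (1 + t)).im| ≤ 2 := by
    rw [Complex.log_im]
    have : |(1 + t).arg| ≤ Real.pi / 2 :=
      Complex.abs_arg_le_pi_div_two_iff.2 (by simp; linarith)
    linarith [Real.pi_le_four]
  have h2 : damping s t - ‖damping s t‖ = ‖damping s t‖ *
      (Complex.exp (Complex.I * ((-(s * (Complex.log (1 + t)).im) : ℝ) : ℂ)) - 1) := by
    rw [mul_sub, ← h1, mul_one]
  rw [h2, norm_mul, Complex.norm_real, norm_norm]
  have h3 := Real.norm_exp_I_mul_ofReal_sub_one_le (x := -(s * (Complex.log (1 + t)).im))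
  rw [Real.norm_eq_abs, abs_neg, abs_mul, abs_of_nonneg hs] at h3
  calc _ ≤ 1 * (s * |(Complex.log (1 + t)).im|) :=
        mul_le_mul hle h3 (norm_nonneg _) zero_le_one
    _ ≤ 2 * s := by nlinarith

lemma hasDerivAt_damping (s : ℝ) {t : ℂ} (ht : 0 ≤ t.re) :
    HasDerivAt (damping s) (damping s t * (-(s * (1 + t)⁻¹))) t := by
  have h1 : HasDerivAt (fun t : ℂ => 1 + t) 1 t := by
    simpa using (hasDerivAt_id t).const_add 1
  have h2 := ((h1.clog (one_add_mem_slitPlane ht)).const_mul (s : ℂ)).neg.cexp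
  refine HasDerivAt.congr_deriv (f := damping s) h2 ?_
  simp [damping, div_eq_mul_inv]

/-- The decay in `t.re` is what matters: in `shear_injOn` it offsets the size of `p`, which is at
most a multiple of `a.re`. -/
lemma norm_deriv_damping_le {s : ℝ} (hs : 0 ≤ s) {t : ℂ} (ht : 0 ≤ t.re) :
    ‖damping s t * (-(s * (1 + t)⁻¹))‖ ≤ s / (1 + t.re) := by
  have h := one_add_re_le_norm t
  rw [norm_mul, norm_neg, norm_mul, norm_inv, Complex.norm_real, Real.norm_of_nonneg hs]
  calc _ ≤ 1 * (s * (1 + t.re)⁻¹) := by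
        gcongr
        exact norm_damping_le_one hs ht
    _ = _ := by ring

lemma convex_rightHalfPlane : Convex ℝ {t : ℂ | 0 ≤ t.re} := convex_halfSpace_re_ge 0

lemma norm_damping_sub_damping_le {s : ℝ} (hs : 0 ≤ s) {a b : ℂ} (ha : 0 ≤ a.re) (hb : 0 ≤ b.re) :
    ‖damping s b - damping s a‖ ≤ s * ‖b - a‖ := by
  refine convex_rightHalfPlane.norm_image_sub_le_of_norm_hasDerivWithin_le
    (fun t ht => (hasDerivAt_damping s ht).hasDerivWithinAt) (fun t ht => ?_) ha hb
  refine (norm_deriv_damping_le hs ht).trans (div_le_self hs ?_)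
  have : 0 ≤ t.re := ht
  linarith

lemma norm_damping_sub_one_le {s : ℝ} (hs : 0 ≤ s) {t : ℂ} (ht : 0 ≤ t.re) :
    ‖damping s t - 1‖ ≤ s * ‖t‖ := by
  simpa [damping_zero] using norm_damping_sub_damping_le hs (a := 0) (by simp) ht

/-- The damping factor tends to `0` at infinity. -/
lemma exists_forall_norm_damping_le {s : ℝ} (hs : 0 < s) {ε : ℝ} (hε : 0 < ε) :
    ∃ R : ℝ, 0 < R ∧ ∀ t : ℂ, R ≤ ‖t‖ → ‖damping s t‖ ≤ ε := by
  -- The exponential solves `r ^ (-s) = ε`; the extra `1` pays for passing from `‖t‖` to `‖1 + t‖`.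
  refine ⟨Real.exp (-(Real.log ε) / s) + 1, by positivity, fun t ht => ?_⟩
  have h1 : Real.exp (-(Real.log ε) / s) ≤ ‖1 + t‖ := by
    have := norm_sub_norm_le t (-1)
    rw [norm_neg, norm_one, sub_neg_eq_add, add_comm t 1] at this
    linarith
  have h2 : -(Real.log ε) / s ≤ Real.log ‖1 + t‖ := by
    rw [Real.le_log_iff_exp_le (lt_of_lt_of_le (Real.exp_pos _) h1)]
    exact h1
  rw [norm_damping, ← Real.le_log_iff_exp_le hε]
  rw [div_le_iff₀ hs] at h2
  linarith

/-! ### One-variable estimates for the shear and the Cayley transform. -/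

section Scalar

/-- With `θ` in place of the damping factor, `a.re - θ p.re` is the convex combination of `a.re ≥
cN` and `a.re - p.re ≥ l - κ ≥ cN - κ`. The exponent `c / (4C)` makes the cost of this replacement
at most `cN/2`. -/
lemma shear_re_lower_bound {a p t : ℂ} {c C κ l N : ℝ} (hc : 0 < c) (hC : 0 < C)
    (hκ : 0 ≤ κ) (ht : 0 ≤ t.re) (hN : 0 ≤ N) (ha : c * N ≤ a.re) (hp : ‖p‖ ≤ C * N)
    (hl : c * N ≤ l) (hal : l + p.re - κ ≤ a.re) :
    c / 2 * N - κ ≤ (a - p * damping (c / (4 * C)) t).re := by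
  obtain ⟨θ, h0, h1, h⟩ := exists_norm_damping_sub_le (s := c / (4 * C)) (by positivity) ht
  have h2 : (p * damping (c / (4 * C)) t).re ≤ θ * p.re + c / 2 * N := by
    have e1 : p * damping (c / (4 * C)) t = θ * p + p * (damping (c / (4 * C)) t - θ) := by ring
    rw [e1, Complex.add_re, Complex.re_ofReal_mul]
    have := Complex.re_le_norm (p * (damping (c / (4 * C)) t - θ))
    rw [norm_mul] at this
    have h3 : ‖p‖ * ‖damping (c / (4 * C)) t - θ‖ ≤ C * N * (2 * (c / (4 * C))) :=
      mul_le_mul hp h (norm_nonneg _) (by positivity)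
    have h4 : C * N * (2 * (c / (4 * C))) = c / 2 * N := by field_simp; ring
    linarith
  rw [Complex.sub_re]
  nlinarith [mul_nonneg (sub_nonneg.2 h1) (sub_nonneg.2 ha),
    mul_nonneg h0 (sub_nonneg.2 hal), mul_nonneg h0 (sub_nonneg.2 hl),
    mul_nonneg (sub_nonneg.2 h1) hκ]

/-- Far away the damping factor is so small that the shear is harmless. -/
lemma shear_re_lower_bound_of_norm_le {a p d : ℂ} {c C N : ℝ} (hC : 0 < C)
    (ha : c * N ≤ a.re) (hp : ‖p‖ ≤ C * N) (hd : ‖d‖ ≤ c / (2 * C)) :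
    c / 2 * N ≤ (a - p * d).re := by
  have h := Complex.re_le_norm (p * d)
  rw [norm_mul] at h
  have h3 : ‖p‖ * ‖d‖ ≤ C * N * (c / (2 * C)) :=
    mul_le_mul hp hd (norm_nonneg _) ((norm_nonneg _).trans hp)
  have h4 : C * N * (c / (2 * C)) = c / 2 * N := by field_simp
  rw [Complex.sub_re]
  linarith

/-- This identity converts the sign and size of `l - u.re` into the position of the Cayley image
relative to the ellipsoid. -/
lemma norm_cayley_sq_add {u : ℂ} (hu : u + 1 ≠ 0) (l : ℝ) :
    ‖(u - 1) / (u + 1)‖ ^ 2 + ‖2 / (u + 1)‖ ^ 2 * l = 1 + 4 * (l - u.re) / ‖u + 1‖ ^ 2 := by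
  have h : ‖u + 1‖ ^ 2 ≠ 0 := by positivity
  have h2 : ‖u - 1‖ ^ 2 = ‖u + 1‖ ^ 2 - 4 * u.re := by
    rw [← Complex.normSq_eq_norm_sq, ← Complex.normSq_eq_norm_sq]
    simp [Complex.normSq_apply]; ring
  rw [norm_div, norm_div, div_pow, div_pow, h2]
  simp only [Complex.norm_ofNat]
  field_simp
  ring

/-- The numerator grows at most linearly in `‖u‖`, because `u.re` controls `N` and hence `l`, while
the denominator grows quadratically. -/
lemma cayley_lt_of_large {u : ℂ} {c C ε l κ N : ℝ} (hc : 0 < c) (hC : c ≤ C) (hε : 0 < ε)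
    (hκ : κ ≤ 1) (hu : 3 + 64 * C / (c * ε) ≤ ‖u‖) (hN0 : 0 ≤ N) (hl : l ≤ C * N)
    (hN : c / 2 * N - κ ≤ u.re) : 4 * (l - u.re) / ‖u + 1‖ ^ 2 < ε := by
  have hC0 : 0 < C := hc.trans_le hC
  have h0 : 0 < 64 * C / (c * ε) := by positivity
  have h1 : (‖u‖ + 1) / 2 ≤ ‖u + 1‖ := by
    have := norm_sub_norm_le u (-1)
    rw [norm_neg, norm_one, sub_neg_eq_add] at this
    linarith
  have h3 := Complex.re_le_norm u
  have h9 : -1 ≤ u.re := by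
    have : 0 ≤ c / 2 * N := by positivity
    linarith
  have h4 : c * (l - u.re) ≤ 3 * C * (‖u‖ + 1) := by
    have : c * l ≤ C * (c * N) := by nlinarith
    nlinarith
  have h5 : 64 * C ≤ (‖u‖ - 3) * (c * ε) := by
    rw [← div_le_iff₀ (by positivity)]; linarith
  have h6 : 0 < ‖u + 1‖ := by linarith
  rw [div_lt_iff₀ (by positivity)]
  have h7 : ((‖u‖ + 1) / 2) ^ 2 ≤ ‖u + 1‖ ^ 2 := by gcongr
  suffices 4 * (l - u.re) < ε * ((‖u‖ + 1) / 2) ^ 2 by nlinarith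
  suffices c * (4 * (l - u.re)) < c * (ε * ((‖u‖ + 1) / 2) ^ 2) from
    lt_of_mul_lt_mul_left this hc.le
  have h10 : 48 * C < c * ε * (‖u‖ + 1) := by nlinarith [mul_pos hc hε]
  have h11 : 48 * C * (‖u‖ + 1) < c * ε * (‖u‖ + 1) * (‖u‖ + 1) :=
    mul_lt_mul_of_pos_right h10 (by linarith)
  linarith

lemma cayley_lt_of_le {u : ℂ} {ε l : ℝ} (hε : 0 < ε) (hre : -(1 / 2) ≤ u.re)
    (hl : l - u.re ≤ ε / 32) : 4 * (l - u.re) / ‖u + 1‖ ^ 2 < ε := by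
  have h1 : 1 / 2 ≤ ‖u + 1‖ := by
    have := Complex.re_le_norm (u + 1)
    rw [Complex.add_re, Complex.one_re] at this
    linarith
  have h7 : (1 / 2 : ℝ) ^ 2 ≤ ‖u + 1‖ ^ 2 := by gcongr
  rw [div_lt_iff₀ (by positivity)]
  nlinarith

lemma add_one_ne_zero_of_re {u : ℂ} (hre : -(1 / 2) ≤ u.re) : u + 1 ≠ 0 := by
  intro h
  have := congrArg Complex.re h
  simp at this
  linarith

/-- The subtracted term has derivative of norm at most `CsN / (T + a.re)`, and `CsN ≤ cN/2 ≤
a.re/2`. The map is the identity minus a contraction, however large `p` is. -/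
lemma shear_injOn {c C N s T : ℝ} (hc : 0 < c) (hs : 0 ≤ s) (hsC : C * s ≤ c / 2) (hT : 0 < T)
    {p : ℂ} (hN : 0 ≤ N) (hp : ‖p‖ ≤ C * N) :
    Set.InjOn (fun a : ℂ => a - p * damping s (a / T)) {a | c * N ≤ a.re} := by
  have hder : ∀ a ∈ {a : ℂ | c * N ≤ a.re}, HasDerivWithinAt (fun a : ℂ => p * damping s (a / T))
      (p * (damping s (a / T) * (-(s * (1 + a / T)⁻¹)) * (1 / T))) {a : ℂ | c * N ≤ a.re} a := by
    intro a ha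
    have ha' : 0 ≤ a.re := (mul_nonneg hc.le hN).trans ha
    have h0 : 0 ≤ (a / T).re := by rw [Complex.div_ofReal_re]; positivity
    have h1 : HasDerivAt (fun a : ℂ => a / (T : ℂ)) (1 / T) a := (hasDerivAt_id a).div_const _
    exact (((hasDerivAt_damping s h0).comp a h1).const_mul p).hasDerivWithinAt
  have hbd : ∀ a ∈ {a : ℂ | c * N ≤ a.re},
      ‖p * (damping s (a / T) * (-(s * (1 + a / T)⁻¹)) * (1 / T))‖ ≤ 1 / 2 := by
    intro a ha
    have ha2 : c * N ≤ a.re := ha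
    have ha' : 0 ≤ a.re := (mul_nonneg hc.le hN).trans ha
    have h0 : 0 ≤ (a / T).re := by rw [Complex.div_ofReal_re]; positivity
    have h1 := norm_deriv_damping_le hs h0
    rw [norm_mul, norm_mul, norm_div, norm_one, Complex.norm_real, Real.norm_of_nonneg hT.le]
    have hCN : 0 ≤ C * N := (norm_nonneg p).trans hp
    calc _ ≤ C * N * (s / (1 + (a / T).re) * (1 / T)) := by gcongr
      _ = C * s * N / (T + a.re) := by
          rw [Complex.div_ofReal_re]; field_simp
      _ ≤ 1 / 2 := by
          rw [div_le_iff₀ (by positivity)]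
          nlinarith
  intro a ha b hb hab
  have h := (convex_halfSpace_re_ge (c * N)).norm_image_sub_le_of_norm_hasDerivWithin_le
    hder hbd ha hb
  have h2 : p * damping s (b / T) - p * damping s (a / T) = b - a := by
    have : a - p * damping s (a / T) = b - p * damping s (b / T) := hab
    linear_combination this
  rw [h2] at h
  have h3 : ‖b - a‖ ≤ 0 := by linarith
  exact (sub_eq_zero.1 (norm_le_zero_iff.1 h3)).symm

/-- The equation `a - p χ(a) = u` is solved by the contraction principle. -/
lemma exists_shear_eq {s T A δ : ℝ} (hs : 0 ≤ s) (hT : 0 < T) {p u : ℂ}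
    (hA : ‖u‖ + ‖p‖ ≤ A) (hpT : ‖p‖ * s ≤ T / 2) (hδ : ‖p‖ * (s * (A / T)) ≤ δ)
    (hre : δ ≤ u.re + p.re) :
    ∃ a : ℂ, a - p * damping s (a / T) = u ∧ ‖a‖ ≤ A ∧ u.re + p.re - δ ≤ a.re ∧ 0 ≤ a.re := by
  -- On this half disc the damping factor is close to `1`, so the iteration stays near `u + p`,
  -- whose real part is at least `δ`; this keeps it in the half disc.
  set K : Set ℂ := {a | 0 ≤ a.re} ∩ Metric.closedBall 0 A with hK
  have hKc : IsComplete K :=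
    ((isClosed_le continuous_const Complex.continuous_re).inter Metric.isClosed_closedBall).isComplete
  set F : ℂ → ℂ := fun a => u + p * damping s (a / T) with hF
  have hT' : ∀ a ∈ K, 0 ≤ (a / T).re := by
    intro a ha
    have : 0 ≤ a.re := ha.1
    rw [Complex.div_ofReal_re]; positivity
  have hest : ∀ a ∈ K, ‖F a‖ ≤ A ∧ u.re + p.re - δ ≤ (F a).re := by
    intro a ha
    have h0 := hT' a ha
    constructor
    · refine (norm_add_le _ _).trans (le_trans ?_ hA)
      rw [norm_mul]
      have := mul_le_mul_of_nonneg_left (norm_damping_le_one hs h0) (norm_nonneg p)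
      linarith
    · have e : F a = u + p + p * (damping s (a / T) - 1) := by simp only [hF]; ring
      have h1 := (abs_le.1 (Complex.abs_re_le_norm (p * (damping s (a / T) - 1)))).1
      have h2 : ‖a‖ ≤ A := by simpa using ha.2
      have h3 : ‖p * (damping s (a / T) - 1)‖ ≤ ‖p‖ * (s * (A / T)) := by
        rw [norm_mul]
        refine mul_le_mul_of_nonneg_left ((norm_damping_sub_one_le hs h0).trans ?_) (norm_nonneg p)
        rw [norm_div, Complex.norm_real, Real.norm_of_nonneg hT.le]
        gcongr
      rw [e, Complex.add_re, Complex.add_re]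
      linarith
  have hmaps : Set.MapsTo F K K := by
    intro a ha
    obtain ⟨h1, h2⟩ := hest a ha
    refine ⟨?_, by simpa using h1⟩
    show 0 ≤ (F a).re
    linarith
  have hlip : LipschitzOnWith (1 / 2) F K := by
    refine LipschitzOnWith.of_dist_le_mul fun a ha b hb => ?_
    have e : F a - F b = p * (damping s (a / T) - damping s (b / T)) := by simp only [hF]; ring
    rw [dist_eq_norm, dist_eq_norm, e, norm_mul]
    have h1 := norm_damping_sub_damping_le hs (hT' b hb) (hT' a ha)
    rw [← sub_div, norm_div, Complex.norm_real, Real.norm_of_nonneg hT.le] at h1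
    calc _ ≤ ‖p‖ * (s * (‖a - b‖ / T)) := by gcongr
      _ = ‖p‖ * s * ‖a - b‖ / T := by ring
      _ ≤ T / 2 * ‖a - b‖ / T := by gcongr
      _ = _ := by push_cast; field_simp
  have h0 : (0 : ℂ) ∈ K := by
    refine ⟨by simp, ?_⟩
    have : 0 ≤ A := by linarith [norm_nonneg u, norm_nonneg p]
    simpa using this
  have hcontr : ContractingWith (1 / 2) (hmaps.restrict F K K) :=
    ⟨by norm_num, (hmaps.lipschitzOnWith_iff_restrict).1 hlip⟩
  obtain ⟨a, haK, hfix, -⟩ := hcontr.exists_fixedPoint' hKc hmaps h0 (edist_ne_top _ _)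
  have hfix' : u + p * damping s (a / T) = a := hfix
  obtain ⟨h1, h2⟩ := hest a haK
  have hFa : F a = a := hfix
  rw [hFa] at h1 h2
  exact ⟨a, by linear_combination -hfix', h1, h2, haK.1⟩

end Scalar

/-! ### The damped shear and Cayley map on a domain trapped between quadrics. -/

section Core

variable {E : Type*} [NormedAddCommGroup E] [InnerProductSpace ℂ E]

/-- The component of `x` orthogonal to the unit vector `e`. -/
noncomputable def perp (e x : E) : E := x - inner ℂ e x • e

lemma inner_perp {e : E} (he : ‖e‖ = 1) (x : E) : inner ℂ e (perp e x) = 0 := by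
  simp [perp, he]

lemma smul_add_perp (e x : E) : inner ℂ e x • e + perp e x = x := by simp [perp]

lemma inner_smul_add {e : E} (he : ‖e‖ = 1) (a : ℂ) {v : E} (hv : inner ℂ e v = 0) :
    inner ℂ e (a • e + v) = a := by
  simp [he, hv]

lemma perp_smul_add {e : E} (he : ‖e‖ = 1) (a : ℂ) {v : E} (hv : inner ℂ e v = 0) :
    perp e (a • e + v) = v := by
  rw [perp, inner_smul_add he a hv]; simp

lemma norm_le_add_perp {e : E} (he : ‖e‖ = 1) (x : E) : ‖x‖ ≤ ‖inner ℂ e x‖ + ‖perp e x‖ := by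
  conv_lhs => rw [← smul_add_perp e x]
  refine (norm_add_le _ _).trans ?_
  rw [norm_smul, he, mul_one]

lemma norm_inner_unit_le {e : E} (he : ‖e‖ = 1) (x : E) : ‖inner ℂ e x‖ ≤ ‖x‖ := by
  simpa [he] using norm_inner_le_norm (𝕜 := ℂ) e x

lemma norm_sq_eq_add_perp {e : E} (he : ‖e‖ = 1) (x : E) :
    ‖x‖ ^ 2 = ‖inner ℂ e x‖ ^ 2 + ‖perp e x‖ ^ 2 := by
  have h : inner ℂ (inner ℂ e x • e) (perp e x) = 0 := by
    rw [inner_smul_left, inner_perp he, mul_zero]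
  have := norm_add_sq_eq_norm_sq_add_norm_sq_of_inner_eq_zero _ _ h
  rw [smul_add_perp, norm_smul, he, mul_one] at this
  nlinarith

lemma norm_perp_le {e : E} (he : ‖e‖ = 1) (x : E) : ‖perp e x‖ ≤ ‖x‖ := by
  have := norm_sq_eq_add_perp he x
  exact le_of_sq_le_sq (by nlinarith [sq_nonneg ‖inner ℂ e x‖]) (norm_nonneg _)

lemma perp_self {e : E} (he : ‖e‖ = 1) : perp e e = 0 := by
  simp [perp, he]

lemma differentiable_inner_unit (e : E) : Differentiable ℂ (fun x : E => inner ℂ e x) :=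
  (innerSL ℂ e).differentiable

lemma differentiable_perp (e : E) : Differentiable ℂ (perp e) :=
  differentiable_id.sub ((differentiable_inner_unit e).smul_const e)

/-- A positive Hermitian part `L` and a holomorphic quadratic part `P` of a real quadratic form
`L + Re P`, with uniform bounds. -/
structure IsLeviPair (c C : ℝ) (L : E → ℝ) (P : E → ℂ) : Prop where
  le_L : ∀ v, c * ‖v‖ ^ 2 ≤ L v
  L_le : ∀ v, L v ≤ C * ‖v‖ ^ 2
  norm_P_le : ∀ v, ‖P v‖ ≤ C * ‖v‖ ^ 2
  le_add : ∀ v, c * ‖v‖ ^ 2 ≤ L v + (P v).re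
  L_smul : ∀ (a : ℂ) v, L (a • v) = ‖a‖ ^ 2 * L v
  differentiable_P : Differentiable ℂ P

/-- The damped shear which removes the holomorphic quadratic part `P`. -/
noncomputable def dampedShear (e : E) (P : E → ℂ) (s T : ℝ) (x : E) : ℂ :=
  inner ℂ e x - P (perp e x) * damping s (inner ℂ e x / T)

/-- The Cayley transform of the point with coordinates `(u, v)`. -/
noncomputable def cayley (e : E) (u : ℂ) (v : E) : E :=
  ((u - 1) / (u + 1)) • e + (2 / (u + 1)) • v

lemma inner_cayley {e : E} (he : ‖e‖ = 1) (u : ℂ) {v : E} (hv : inner ℂ e v = 0) :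
    inner ℂ e (cayley e u v) = (u - 1) / (u + 1) :=
  inner_smul_add he _ (by rw [inner_smul_right, hv, mul_zero])

lemma perp_cayley {e : E} (he : ‖e‖ = 1) (u : ℂ) {v : E} (hv : inner ℂ e v = 0) :
    perp e (cayley e u v) = (2 / (u + 1)) • v :=
  perp_smul_add he _ (by rw [inner_smul_right, hv, mul_zero])

lemma cayley_injective {e : E} (he : ‖e‖ = 1) {u u' : ℂ} {v v' : E} (hu : u + 1 ≠ 0)
    (hu' : u' + 1 ≠ 0) (hv : inner ℂ e v = 0) (hv' : inner ℂ e v' = 0)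
    (h : cayley e u v = cayley e u' v') : u = u' ∧ v = v' := by
  have h1 := congrArg (inner ℂ e) h
  rw [inner_cayley he u hv, inner_cayley he u' hv', div_eq_div_iff hu hu'] at h1
  have h2 : u = u' := by linear_combination h1 / 2
  refine ⟨h2, ?_⟩
  have h3 := congrArg (perp e) h
  rw [perp_cayley he u hv, perp_cayley he u' hv', ← h2] at h3
  exact smul_right_injective E (div_ne_zero two_ne_zero hu) h3

lemma differentiableOn_dampedShear {e : E} {P : E → ℂ} (hP : Differentiable ℂ P) (s : ℝ) {T : ℝ}
    (hT : 0 < T) {D : Set E} (hD : ∀ x ∈ D, 0 ≤ (inner ℂ e x).re) :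
    DifferentiableOn ℂ (dampedShear e P s T) D := by
  intro x hx
  have h0 : 0 ≤ (inner ℂ e x / (T : ℂ)).re := by
    rw [Complex.div_ofReal_re]
    exact div_nonneg (hD x hx) hT.le
  have h1 : DifferentiableAt ℂ (fun x : E => inner ℂ e x / (T : ℂ)) x := by
    simp only [div_eq_mul_inv]
    exact (differentiable_inner_unit e x).mul_const _
  have h2 : DifferentiableAt ℂ (fun x : E => damping s (inner ℂ e x / (T : ℂ))) x :=
    DifferentiableAt.comp (g := damping s) x (hasDerivAt_damping s h0).differentiableAt h1
  exact ((differentiable_inner_unit e x).sub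
    ((hP.comp (differentiable_perp e) x).mul h2)).differentiableWithinAt

/-- The inverse Cayley transform is `u = (1 + w)/(1 - w)`. The margin `ε` keeps `w` away from `1`,
which bounds `u`; since `‖u + 1‖ ≥ 1`, the margin survives as a gap `ε/4` in the half-space picture.
-/
lemma exists_cayley_eq {e : E} (he : ‖e‖ = 1) {ε : ℝ} (hε : 0 < ε) {L : E → ℝ}
    (hLs : ∀ (a : ℂ) v, L (a • v) = ‖a‖ ^ 2 * L v) (hL : ∀ v, 0 ≤ L v) {z : E}
    (hz : ‖inner ℂ e z‖ ^ 2 + L (perp e z) < 1 - ε) :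
    ∃ (u : ℂ) (v : E), inner ℂ e v = 0 ∧ cayley e u v = z ∧ ‖u‖ ≤ 4 / ε ∧ ε / 4 < u.re - L v := by
  set w : ℂ := inner ℂ e z with hw
  have hL0 : 0 ≤ L (perp e z) := hL _
  have hw1 : ‖w‖ < 1 := by nlinarith [norm_nonneg w]
  have hw2 : ε / 2 ≤ 1 - ‖w‖ := by nlinarith [norm_nonneg w]
  have hw3 : ε / 2 ≤ ‖1 - w‖ := by
    have := norm_sub_norm_le 1 w
    rw [norm_one] at this
    linarith
  have hw4 : ‖1 - w‖ ≤ 2 := by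
    have := norm_sub_le 1 w
    rw [norm_one] at this
    linarith
  have hw5 : 1 - w ≠ 0 := by
    intro h
    rw [h, norm_zero] at hw3
    linarith
  set u : ℂ := (1 + w) / (1 - w) with hu_def
  have hu1 : u + 1 = 2 / (1 - w) := by rw [hu_def]; field_simp; ring
  have hu2 : u + 1 ≠ 0 := by rw [hu1]; exact div_ne_zero two_ne_zero hw5
  have huw : (u - 1) / (u + 1) = w := by rw [hu1, hu_def]; field_simp; ring
  set v : E := ((u + 1) / 2) • perp e z with hv_def
  have hve : inner ℂ e v = 0 := by rw [hv_def, inner_smul_right, inner_perp he, mul_zero]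
  have hzv : cayley e u v = z := by
    have h1 : 2 / (u + 1) * ((u + 1) / 2) = 1 := by field_simp
    rw [cayley, huw, hv_def, smul_smul, h1, one_smul, hw, smul_add_perp]
  have hperpz : perp e z = (2 / (u + 1)) • v := by
    rw [← perp_cayley he u hve, hzv]
  rw [← huw, hperpz, hLs, norm_cayley_sq_add hu2] at hz
  have hu3 : ‖u + 1‖ = 2 / ‖1 - w‖ := by rw [hu1, norm_div]; simp
  have hu4 : 1 ≤ ‖u + 1‖ := by
    rw [hu3, le_div_iff₀ (by linarith)]; linarith
  have hu5 : ‖u‖ ≤ 4 / ε := by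
    rw [hu_def, norm_div]
    calc ‖1 + w‖ / ‖1 - w‖ ≤ 2 / (ε / 2) := by
          gcongr
          have := norm_add_le 1 w
          rw [norm_one] at this
          linarith
      _ = 4 / ε := by field_simp; norm_num
  have hgap : ε / 4 < u.re - L v := by
    have h4 : 4 * (L v - u.re) / ‖u + 1‖ ^ 2 < -ε := by linarith
    rw [div_lt_iff₀ (by positivity)] at h4
    have : 1 ≤ ‖u + 1‖ ^ 2 := one_le_pow₀ hu4
    nlinarith
  exact ⟨u, v, hve, hzv, hu5, hgap⟩

/-- On a domain trapped between the two quadrics the Cayley transform of the damped shear is an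
injective holomorphic map whose image is close to the ellipsoid `|z₁|² + L(z') < 1`. -/
theorem exists_cayley_map (E : Type*) [NormedAddCommGroup E] [InnerProductSpace ℂ E]
    {c C ε : ℝ} (hc : 0 < c) (hcC : c ≤ C) (hε : 0 < ε) (hε1 : ε ≤ 1) :
    ∃ κ > 0, ∃ M > 0, ∀ (L : E → ℝ) (P : E → ℂ), IsLeviPair c C L P → ∀ e : E, ‖e‖ = 1 →
      ∀ D : Set E, (∀ x ∈ D, c * ‖perp e x‖ ^ 2 ≤ (inner ℂ e x).re) →
      (∀ x ∈ D, ‖x‖ ≤ M → L (perp e x) + (P (perp e x)).re - κ ≤ (inner ℂ e x).re) →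
      (∀ x, ‖x‖ ≤ M → L (perp e x) + (P (perp e x)).re + κ < (inner ℂ e x).re → x ∈ D) →
      ∃ Φ : E → E, DifferentiableOn ℂ Φ D ∧ Set.InjOn Φ D ∧ Φ e = 0 ∧
        (∀ x ∈ D, ‖inner ℂ e (Φ x)‖ ^ 2 + L (perp e (Φ x)) < 1 + ε) ∧
        ∀ z, ‖inner ℂ e z‖ ^ 2 + L (perp e z) < 1 - ε → z ∈ Φ '' D := by
  have hC : 0 < C := hc.trans_le hcC
  set s : ℝ := c / (4 * C) with hs_def
  have hs : 0 < s := by positivity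
  have hCs : C * s = c / 4 := by rw [hs_def]; field_simp
  set M₁ : ℝ := 3 + 64 * C / (c * ε) with hM₁
  have hM₁0 : 0 < M₁ := by positivity
  -- The first summand serves points of `D` with `‖g x‖ < M₁`, the second serves preimages of points
  -- of the smaller ellipsoid.
  set B : ℝ := 2 / c * (M₁ + 1) + 4 / (ε * c) with hB
  have hB0 : 0 < B := by positivity
  have hB1 : 2 / c * (M₁ + 1) ≤ B := by
    have : 0 < 4 / (ε * c) := by positivity
    linarith
  have hB2 : 4 / (ε * c) ≤ B := by
    have : 0 < 2 / c * (M₁ + 1) := by positivity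
    linarith
  set A : ℝ := M₁ + 4 / ε + C * B with hA
  have hA0 : 0 < A := by positivity
  -- `B` bounds `‖v‖²`, `A` bounds `|x₁|` in the bounded region
  set T : ℝ := 1 + 64 * (C * B) * (s * (A + 1)) / ε with hT_def
  have hT : 0 < T := by positivity
  have hTε : C * B * (s * (A / T)) ≤ ε / 64 := by
    have h1 : 64 * (C * B) * (s * (A + 1)) = (T - 1) * ε := by rw [hT_def]; field_simp; ring
    have h2 : C * B * (s * A) ≤ ε / 64 * T := by nlinarith [mul_pos (mul_pos hC hB0) hs]
    calc C * B * (s * (A / T)) = C * B * (s * A) / T := by ring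
      _ ≤ ε / 64 := by rw [div_le_iff₀ hT]; exact h2
  have hTs : C * B * s ≤ T / 2 := by
    have h1 : 64 * (C * B) * (s * (A + 1)) = (T - 1) * ε := by rw [hT_def]; field_simp; ring
    have h3 : 0 < C * B * s := by positivity
    have h4 : (T - 1) * ε ≤ T - 1 := by
      have : 0 ≤ T - 1 := by rw [hT_def, add_sub_cancel_left]; positivity
      nlinarith
    nlinarith
  obtain ⟨R, hR, hdamp⟩ := exists_forall_norm_damping_le hs (ε := c / (2 * C)) (by positivity)
  -- `A + (B + 1)` bounds `‖x‖` in the bounded region. The remaining summands ensure that `‖x‖ > M`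
  -- forces `‖x₁‖ ≥ R T`, where the damping factor is at most `c / (2C)`.
  set M : ℝ := A + (B + 1) + (R * T + (R * T / c + 1)) with hM
  have hM0 : 0 < M := by positivity
  refine ⟨ε / 64, by positivity, M, hM0, fun L P hLP e he D h1 h2 h3 => ?_⟩
  have hnn : ∀ x ∈ D, 0 ≤ (inner ℂ e x).re := fun x hx => by
    have : 0 ≤ c * ‖perp e x‖ ^ 2 := by positivity
    exact this.trans (h1 x hx)
  have hnnT : ∀ x ∈ D, 0 ≤ (inner ℂ e x / (T : ℂ)).re := fun x hx => by
    rw [Complex.div_ofReal_re]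
    exact div_nonneg (hnn x hx) hT.le
  have hle_sq : ∀ r : ℝ, r ≤ r ^ 2 + 1 := fun r => by nlinarith [sq_nonneg (r - 1)]
  set g : E → ℂ := dampedShear e P s T with hg
  have hglow : ∀ x ∈ D, c / 2 * ‖perp e x‖ ^ 2 - ε / 64 ≤ (g x).re := by
    intro x hx
    by_cases hxM : ‖x‖ ≤ M
    · exact shear_re_lower_bound hc hC (by positivity) (hnnT x hx) (by positivity) (h1 x hx)
        (hLP.norm_P_le _) (hLP.le_L _) (h2 x hx hxM)
    · have hfar : R * T ≤ ‖inner ℂ e x‖ := by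
        by_contra! hlt
        apply hxM
        have e1 : c * ‖perp e x‖ ^ 2 ≤ R * T :=
          (h1 x hx).trans ((Complex.re_le_norm _).trans hlt.le)
        have e2 : ‖perp e x‖ ^ 2 ≤ R * T / c := by rw [le_div_iff₀ hc]; linarith
        have e3 := norm_le_add_perp he x
        have e4 := hle_sq ‖perp e x‖
        linarith
      have hd : ‖damping s (inner ℂ e x / (T : ℂ))‖ ≤ c / (2 * C) := by
        apply hdamp
        rw [norm_div, Complex.norm_real, Real.norm_of_nonneg hT.le, le_div_iff₀ hT]
        exact hfar
      have := shear_re_lower_bound_of_norm_le hC (h1 x hx) (hLP.norm_P_le _) hd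
      have e5 : (g x).re = (inner ℂ e x -
        P (perp e x) * damping s (inner ℂ e x / (T : ℂ))).re := rfl
      linarith
  have hgre : ∀ x ∈ D, -(1 / 2) ≤ (g x).re := fun x hx => by
    have : 0 ≤ c / 2 * ‖perp e x‖ ^ 2 := by positivity
    linarith [hglow x hx]
  have hg1 : ∀ x ∈ D, g x + 1 ≠ 0 := fun x hx => add_one_ne_zero_of_re (hgre x hx)
  have hgd : DifferentiableOn ℂ g D :=
    differentiableOn_dampedShear hLP.differentiable_P s hT hnn
  have hP0 : P 0 = 0 := by
    have := hLP.norm_P_le 0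
    simpa using this
  refine ⟨fun x => cayley e (g x) (perp e x), ?_, ?_, ?_, ?_, ?_⟩
  · have hpd : DifferentiableOn ℂ (perp e) D := (differentiable_perp e).differentiableOn
    have hinv : DifferentiableOn ℂ (fun x => (g x + 1)⁻¹) D := (hgd.add_const 1).inv hg1
    have ha : DifferentiableOn ℂ (fun x => (g x - 1) / (g x + 1)) D := by
      simp only [div_eq_mul_inv]
      exact (hgd.sub_const 1).mul hinv
    have hb : DifferentiableOn ℂ (fun x => 2 / (g x + 1)) D := by
      simp only [div_eq_mul_inv]
      exact hinv.const_mul 2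
    exact (ha.smul_const e).add (hb.smul hpd)
  · intro x hx y hy hxy
    obtain ⟨e1, e2⟩ := cayley_injective he (hg1 x hx) (hg1 y hy) (inner_perp he x)
      (inner_perp he y) hxy
    have hinj := shear_injOn (c := c) (C := C) (N := ‖perp e x‖ ^ 2) hc hs.le (by linarith) hT
      (by positivity) (hLP.norm_P_le (perp e x))
    have hy1 : c * ‖perp e x‖ ^ 2 ≤ (inner ℂ e y).re := by rw [e2]; exact h1 y hy
    have e3 : inner ℂ e x = inner ℂ e y := by
      refine hinj (h1 x hx) hy1 ?_
      have e4 : g y = inner ℂ e y - P (perp e y) * damping s (inner ℂ e y / T) := rfl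
      rw [← e2] at e4
      exact e1.trans e4
    rw [← smul_add_perp e x, ← smul_add_perp e y, e3, e2]
  · have e1 : g e = 1 := by
      show inner ℂ e e - P (perp e e) * _ = 1
      rw [perp_self he, hP0, zero_mul, sub_zero, inner_self_eq_norm_sq_to_K, he]
      simp
    simp only [e1, perp_self he, cayley]
    simp
  · intro x hx
    simp only
    rw [inner_cayley he _ (inner_perp he x), perp_cayley he _ (inner_perp he x), hLP.L_smul,
      norm_cayley_sq_add (hg1 x hx)]
    suffices 4 * (L (perp e x) - (g x).re) / ‖g x + 1‖ ^ 2 < ε by linarith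
    -- For large `g x` the coarse bound `hglow` suffices. Otherwise `x` lies in the ball of radius
    -- `M`, where the osculating quadric is available and the total error is `κ + ε/64 = ε/32`.
    by_cases hu : M₁ ≤ ‖g x‖
    · exact cayley_lt_of_large hc hcC hε (by linarith) hu (by positivity) (hLP.L_le _)
        (hglow x hx)
    · push Not at hu
      have hv : ‖perp e x‖ ^ 2 ≤ B := by
        refine le_trans ?_ hB1
        have := hglow x hx
        have h4 := Complex.re_le_norm (g x)
        rw [div_mul_eq_mul_div, le_div_iff₀ hc]
        linarith
      have hPB : ‖P (perp e x)‖ ≤ C * B := (hLP.norm_P_le _).trans (by gcongr)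
      have hx1 : ‖inner ℂ e x‖ ≤ A := by
        have e1 : inner ℂ e x = g x + P (perp e x) * damping s (inner ℂ e x / (T : ℂ)) := by
          simp [hg, dampedShear]
        rw [e1]
        refine (norm_add_le _ _).trans ?_
        rw [norm_mul]
        have e2 := mul_le_mul hPB (norm_damping_le_one hs.le (hnnT x hx)) (norm_nonneg _)
          (by positivity)
        have : 0 < 4 / ε := by positivity
        linarith
      have hxM : ‖x‖ ≤ M := by
        have e3 := norm_le_add_perp he x
        have e4 := hle_sq ‖perp e x‖
        have : 0 < R * T + (R * T / c + 1) := by positivity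
        linarith
      refine cayley_lt_of_le hε (hgre x hx) ?_
      have e5 : (g x).re = (inner ℂ e x).re - (P (perp e x)).re -
          (P (perp e x) * (damping s (inner ℂ e x / (T : ℂ)) - 1)).re := by
        rw [← Complex.sub_re, ← Complex.sub_re]
        congr 1
        simp only [hg, dampedShear]
        ring
      have e6 : ‖P (perp e x) * (damping s (inner ℂ e x / (T : ℂ)) - 1)‖ ≤ ε / 64 := by
        rw [norm_mul]
        refine le_trans ?_ hTε
        refine mul_le_mul hPB ((norm_damping_sub_one_le hs.le (hnnT x hx)).trans ?_)
          (norm_nonneg _) (by positivity)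
        rw [norm_div, Complex.norm_real, Real.norm_of_nonneg hT.le]
        gcongr
      have e7 := Complex.re_le_norm (P (perp e x) * (damping s (inner ℂ e x / (T : ℂ)) - 1))
      have e8 := h2 x hx hxM
      linarith
  · intro z hz
    obtain ⟨u, v, hve, hzv, hu5, hgap⟩ := exists_cayley_eq he hε hLP.L_smul
      (fun v => le_trans (by positivity) (hLP.le_L v)) hz
    have hvB : ‖v‖ ^ 2 ≤ B := by
      refine le_trans ?_ hB2
      rw [le_div_iff₀ (by positivity)]
      have h5 := hLP.le_L v
      have h6 := Complex.re_le_norm u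
      have h7 : c * ‖v‖ ^ 2 ≤ 4 / ε := by linarith
      rw [le_div_iff₀ hε] at h7
      linarith
    have hPB : ‖P v‖ ≤ C * B := (hLP.norm_P_le _).trans (by gcongr)
    have hH := hLP.le_add v
    have hH0 : 0 ≤ c * ‖v‖ ^ 2 := by positivity
    obtain ⟨a, ha1, ha2, ha3, -⟩ := exists_shear_eq (A := A) (δ := ε / 64) (p := P v) (u := u)
      hs.le hT (by linarith) ((mul_le_mul_of_nonneg_right hPB hs.le).trans hTs)
      ((mul_le_mul_of_nonneg_right hPB (by positivity)).trans hTε) (by linarith)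
    have hx1 : inner ℂ e (a • e + v) = a := inner_smul_add he a hve
    have hx2 : perp e (a • e + v) = v := perp_smul_add he a hve
    refine ⟨a • e + v, h3 _ ?_ ?_, ?_⟩
    · have e3 := norm_le_add_perp he (a • e + v)
      rw [hx1, hx2] at e3
      have e4 := hle_sq ‖v‖
      have : 0 < R * T + (R * T / c + 1) := by positivity
      linarith
    · rw [hx1, hx2]
      linarith
    · have e1 : g (a • e + v) = u := by
        show dampedShear e P s T _ = u
        rw [dampedShear, hx1, hx2, ha1]
      simp only [e1, hx2, hzv]

end Core

/-! ### Hermitian and holomorphic parts of a real quadratic form. -/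

/-- A finite dimensional complex inner product is the pullback of the standard one. -/
lemma InnerProductSpace.Core.exists_linearEquiv {V : Type*} [AddCommGroup V] [Module ℂ V]
    [FiniteDimensional ℂ V] {n : ℕ} (hn : Module.finrank ℂ V = n)
    (core : InnerProductSpace.Core ℂ V) :
    ∃ A : V ≃ₗ[ℂ] EuclideanSpace ℂ (Fin n), ∀ v, ‖A v‖ ^ 2 = (core.inner v v).re := by
  let _ : NormedAddCommGroup V := core.toNormedAddCommGroup
  let _ : InnerProductSpace ℂ V := InnerProductSpace.ofCore core.toCore
  let b := (stdOrthonormalBasis ℂ V).reindex (finCongr hn)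
  refine ⟨b.repr.toLinearEquiv, fun v => ?_⟩
  have h : ‖b.repr v‖ = ‖v‖ := b.repr.norm_map v
  have h2 : ‖v‖ ^ 2 = (inner ℂ v v).re := (inner_self_eq_norm_sq (𝕜 := ℂ) v).symm
  calc ‖b.repr v‖ ^ 2 = ‖v‖ ^ 2 := by rw [h]
    _ = _ := h2

section Forms

variable {n : ℕ}

lemma complex_smul_eq (a : ℂ) (v : Cn n) : a • v = a.re • v + a.im • (Complex.I • v) := by
  ext i
  simp only [PiLp.smul_apply, PiLp.add_apply, smul_eq_mul, Complex.real_smul]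
  conv_lhs => rw [← Complex.re_add_im a]
  ring

lemma I_smul_I_smul (v : Cn n) : Complex.I • Complex.I • v = -v := by
  rw [smul_smul, Complex.I_mul_I, neg_one_smul]

lemma I_smul_real_smul (r : ℝ) (v : Cn n) : Complex.I • r • v = r • Complex.I • v := by
  ext i
  simp only [PiLp.smul_apply, smul_eq_mul, Complex.real_smul]
  ring

variable (B : Cn n →L[ℝ] Cn n →L[ℝ] ℝ)

/-- The Hermitian part of a real quadratic form. -/
noncomputable def hermPart (v : Cn n) : ℝ := (B v v + B (Complex.I • v) (Complex.I • v)) / 2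

/-- The Hermitian form whose quadratic form is `hermPart`. -/
noncomputable def hermForm (v w : Cn n) : ℂ :=
  ⟨(B v w + B (Complex.I • v) (Complex.I • w)) / 2,
    -((B v (Complex.I • w) - B (Complex.I • v) w) / 2)⟩

/-- The complex bilinear part of a real bilinear form. -/
noncomputable def bilinPart (v w : Cn n) : ℂ :=
  ⟨(B v w - B (Complex.I • v) (Complex.I • w)) / 2,
    -((B v (Complex.I • w) + B (Complex.I • v) w) / 2)⟩

lemma hermForm_add_left (u v w : Cn n) : hermForm B (u + v) w = hermForm B u w + hermForm B v w := by
  apply Complex.ext <;> simp [hermForm] <;> ring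

lemma bilinPart_add_left (u v w : Cn n) :
    bilinPart B (u + v) w = bilinPart B u w + bilinPart B v w := by
  apply Complex.ext <;> simp [bilinPart] <;> ring

lemma bilinPart_add_right (u v w : Cn n) :
    bilinPart B u (v + w) = bilinPart B u v + bilinPart B u w := by
  apply Complex.ext <;> simp [bilinPart] <;> ring

lemma hermForm_smul_left (a : ℂ) (v w : Cn n) :
    hermForm B (a • v) w = (starRingEnd ℂ) a * hermForm B v w := by
  rw [complex_smul_eq a v]
  apply Complex.ext <;>
    simp [hermForm, I_smul_real_smul, I_smul_I_smul] <;> ring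

lemma bilinPart_smul_left (a : ℂ) (v w : Cn n) :
    bilinPart B (a • v) w = a * bilinPart B v w := by
  rw [complex_smul_eq a v]
  apply Complex.ext <;>
    simp [bilinPart, I_smul_real_smul, I_smul_I_smul] <;> ring

lemma bilinPart_smul_right (a : ℂ) (v w : Cn n) :
    bilinPart B v (a • w) = a * bilinPart B v w := by
  rw [complex_smul_eq a w]
  apply Complex.ext <;>
    simp [bilinPart, I_smul_real_smul, I_smul_I_smul] <;> ring

lemma differentiable_bilinPart_self : Differentiable ℂ (fun v => bilinPart B v v) := by
  let S : Cn n →ₗ[ℂ] Cn n →ₗ[ℂ] ℂ := LinearMap.mk₂ ℂ (bilinPart B) (bilinPart_add_left B)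
    (bilinPart_smul_left B) (bilinPart_add_right B) (bilinPart_smul_right B)
  let S' : Cn n →L[ℂ] Cn n →L[ℂ] ℂ :=
    (LinearMap.toContinuousLinearMap.toLinearMap ∘ₗ S).toContinuousLinearMap
  exact fun v => (S'.differentiable v).clm_apply differentiableAt_id

variable {B}

lemma hermForm_conj_symm (hB : ∀ v w, B v w = B w v) (v w : Cn n) :
    (starRingEnd ℂ) (hermForm B w v) = hermForm B v w := by
  apply Complex.ext <;> simp [hermForm, hB v w, hB (Complex.I • v) (Complex.I • w),
    hB v (Complex.I • w), hB (Complex.I • v) w]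
  ring

lemma hermForm_self (hB : ∀ v w, B v w = B w v) (v : Cn n) :
    hermForm B v v = hermPart B v := by
  apply Complex.ext <;> simp [hermForm, hermPart, hB (Complex.I • v) v]

lemma hermPart_smul (hB : ∀ v w, B v w = B w v) (a : ℂ) (v : Cn n) :
    hermPart B (a • v) = ‖a‖ ^ 2 * hermPart B v := by
  rw [← Complex.normSq_eq_norm_sq, Complex.normSq_apply, complex_smul_eq a v]
  simp [hermPart, I_smul_real_smul, I_smul_I_smul, hB (Complex.I • v) v]
  ring

lemma apply_le_of_norm_le {K : ℝ} (hK : ‖B‖ ≤ K) (v w : Cn n) : |B v w| ≤ K * (‖v‖ * ‖w‖) := by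
  have := B.le_opNorm₂ v w
  rw [Real.norm_eq_abs] at this
  refine this.trans ?_
  rw [mul_assoc]
  gcongr

/-- Averaging `B` over `v` and `I • v`, which have equal norm, preserves the lower bound `c`. The
constant doubles because the real and imaginary parts of the bilinear part are bounded separately by
`K‖v‖²`. -/
lemma isLeviPair_of_bilin (hB : ∀ v w, B v w = B w v) {c K : ℝ} (hK : ‖B‖ ≤ K)
    (hc : ∀ v, c * ‖v‖ ^ 2 ≤ B v v) :
    IsLeviPair c (2 * K) (hermPart B) (fun v => bilinPart B v v) where
  le_L v := by
    have h1 := hc v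
    have h2 := hc (Complex.I • v)
    rw [norm_smul, Complex.norm_I, one_mul] at h2
    rw [hermPart]; linarith
  L_le v := by
    have h1 := (abs_le.1 (apply_le_of_norm_le hK v v)).2
    have h2 := (abs_le.1 (apply_le_of_norm_le hK (Complex.I • v) (Complex.I • v))).2
    rw [norm_smul, Complex.norm_I, one_mul] at h2
    have h3 : 0 ≤ K * (‖v‖ * ‖v‖) := (abs_nonneg _).trans (apply_le_of_norm_le hK v v)
    rw [hermPart, sq]; linarith
  norm_P_le v := by
    have h1 := abs_le.1 (apply_le_of_norm_le hK v v)
    have h2 := abs_le.1 (apply_le_of_norm_le hK (Complex.I • v) (Complex.I • v))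
    have h3 := abs_le.1 (apply_le_of_norm_le hK v (Complex.I • v))
    have h4 := abs_le.1 (apply_le_of_norm_le hK (Complex.I • v) v)
    rw [norm_smul, Complex.norm_I, one_mul] at h2 h3 h4
    have h := Complex.norm_le_abs_re_add_abs_im (bilinPart B v v)
    have h5 : |(bilinPart B v v).re| ≤ K * (‖v‖ * ‖v‖) := by
      rw [abs_le]; simp only [bilinPart]; constructor <;> linarith
    have h6 : |(bilinPart B v v).im| ≤ K * (‖v‖ * ‖v‖) := by
      rw [abs_le]; simp only [bilinPart]; constructor <;> linarith
    rw [sq]; linarith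
  le_add v := by
    have : hermPart B v + (bilinPart B v v).re = B v v := by
      simp only [hermPart, bilinPart]; ring
    rw [this]; exact hc v
  L_smul a v := hermPart_smul hB a v
  differentiable_P := differentiable_bilinPart_self B

lemma hermPart_add_bilinPart_re (v : Cn n) : hermPart B v + (bilinPart B v v).re = B v v := by
  simp only [hermPart, bilinPart]; ring

/-- The ellipsoid `|z₁|² + L(z') < 1` is linearly equivalent to the unit ball. -/
lemma exists_linearEquiv_norm_sq (hB : ∀ v w, B v w = B w v) {c : ℝ} (hc0 : 0 < c)
    (hc : ∀ v, c * ‖v‖ ^ 2 ≤ B v v) (e : Cn n) :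
    ∃ A : Cn n ≃ₗ[ℂ] Cn n, ∀ z, ‖A z‖ ^ 2 = ‖inner ℂ e z‖ ^ 2 + hermPart B (perp e z) := by
  have hL := (isLeviPair_of_bilin hB le_rfl hc).le_L
  have hperp_add : ∀ x y : Cn n, perp e (x + y) = perp e x + perp e y := fun x y => by
    simp only [perp, inner_add_right, add_smul]; abel
  have hperp_smul : ∀ (a : ℂ) (x : Cn n), perp e (a • x) = a • perp e x := fun a x => by
    simp only [perp, inner_smul_right, smul_sub, smul_smul]
  have hself : ∀ x : Cn n, hermForm B (perp e x) (perp e x) +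
      (starRingEnd ℂ) (inner ℂ e x) * inner ℂ e x =
      ((‖inner ℂ e x‖ ^ 2 + hermPart B (perp e x) : ℝ) : ℂ) := fun x => by
    rw [hermForm_self hB, Complex.conj_mul']; push_cast; ring
  -- Polarization of the ellipsoid's quadratic form; an orthonormal basis for this inner product
  -- straightens the ellipsoid to a ball.
  let core : InnerProductSpace.Core ℂ (Cn n) :=
    { inner := fun x y => hermForm B (perp e x) (perp e y) +
        (starRingEnd ℂ) (inner ℂ e x) * inner ℂ e y
      conj_inner_symm := fun x y => by
        simp only [map_add, map_mul, hermForm_conj_symm hB, Complex.conj_conj]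
        ring
      re_inner_nonneg := fun x => by
        rw [hself]
        have := hL (perp e x)
        have h2 : 0 ≤ hermPart B (perp e x) := le_trans (by positivity) this
        simp only [RCLike.re_to_complex, Complex.ofReal_re]
        positivity
      add_left := fun x y z => by
        simp only [hperp_add, hermForm_add_left, inner_add_right, map_add]; ring
      smul_left := fun x y a => by
        simp only [hperp_smul, hermForm_smul_left, inner_smul_right, map_mul]; ring
      definite := fun x hx => by
        rw [hself, Complex.ofReal_eq_zero] at hx
        have h1 := hL (perp e x)
        have h2 : 0 ≤ c * ‖perp e x‖ ^ 2 := by positivity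
        have h3 : ‖inner ℂ e x‖ ^ 2 = 0 := by nlinarith [sq_nonneg ‖inner ℂ e x‖]
        have h4 : c * ‖perp e x‖ ^ 2 = 0 := by nlinarith [sq_nonneg ‖inner ℂ e x‖]
        have h5 : inner ℂ e x = 0 := by simpa using h3
        have h6 : perp e x = 0 := by simpa [hc0.ne'] using h4
        rw [← smul_add_perp e x, h5, h6]; simp }
  obtain ⟨A, hA⟩ := InnerProductSpace.Core.exists_linearEquiv (n := n) (by simp) core
  refine ⟨A, fun z => ?_⟩
  rw [hA]
  show (hermForm B (perp e z) (perp e z) + (starRingEnd ℂ) (inner ℂ e z) * inner ℂ e z).re = _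
  rw [hself, Complex.ofReal_re]

end Forms

/-! ### Anisotropic dilation and lower bounds for the squeezing function. -/

section Squeezing

variable {n : ℕ}

/-- The unit vector encodes `n ≥ 1`: in dimension `0` all balls of positive radius coincide. -/
lemma le_one_of_ball_subset {e : Cn n} (he : ‖e‖ = 1) {r : ℝ}
    (h : Metric.ball (0 : Cn n) r ⊆ Metric.ball 0 1) : r ≤ 1 := by
  by_contra! hr
  have : e ∈ Metric.ball (0 : Cn n) 1 := h (by simpa [he] using hr)
  simp [he] at this

lemma squeezing_radius_le_one {e : Cn n} (he : ‖e‖ = 1) {Ω : Set (Cn n)} {q : Cn n} {r : ℝ}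
    (hr : r ∈ {r : ℝ | 0 < r ∧ ∃ f ∈ squeezingMaps Ω q, Metric.ball (0 : Cn n) r ⊆ f '' Ω}) :
    r ≤ 1 := by
  obtain ⟨-, f, hf, hr⟩ := hr
  exact le_one_of_ball_subset he (hr.trans hf.2.2.1.image_subset)

lemma squeezingFunction_le_one {e : Cn n} (he : ‖e‖ = 1) (Ω : Set (Cn n)) (q : Cn n) :
    squeezingFunction Ω q ≤ 1 :=
  Real.sSup_le (fun _ hr => squeezing_radius_le_one he hr) zero_le_one

lemma le_squeezingFunction {e : Cn n} (he : ‖e‖ = 1) {Ω : Set (Cn n)} {q : Cn n} {r : ℝ}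
    (hr : 0 < r) {f : Cn n → Cn n} (hf : f ∈ squeezingMaps Ω q)
    (hb : Metric.ball (0 : Cn n) r ⊆ f '' Ω) : r ≤ squeezingFunction Ω q :=
  le_csSup ⟨1, fun _ h => squeezing_radius_le_one he h⟩ ⟨hr, f, hf, hb⟩

lemma real_smul_eq (r : ℝ) (v : Cn n) : r • v = (r : ℂ) • v := by
  ext i; simp

/-- The anisotropic dilation with weight `t ^ 2` along `e` and `t` across. -/
noncomputable def dilation (e : Cn n) (t : ℝ) (x : Cn n) : Cn n :=
  (t ^ 2) • (inner ℂ e x • e) + t • perp e x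

lemma inner_dilation {e : Cn n} (he : ‖e‖ = 1) (t : ℝ) (x : Cn n) :
    inner ℂ e (dilation e t x) = (t : ℂ) ^ 2 * inner ℂ e x := by
  rw [dilation, real_smul_eq, real_smul_eq, smul_smul,
    inner_smul_add he _ (by rw [inner_smul_right, inner_perp he, mul_zero])]
  push_cast; rfl

lemma perp_dilation {e : Cn n} (he : ‖e‖ = 1) (t : ℝ) (x : Cn n) :
    perp e (dilation e t x) = (t : ℂ) • perp e x := by
  rw [dilation, real_smul_eq, real_smul_eq, smul_smul,
    perp_smul_add he _ (by rw [inner_smul_right, inner_perp he, mul_zero])]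

lemma dilation_dilation {e : Cn n} (he : ‖e‖ = 1) (s t : ℝ) (x : Cn n) :
    dilation e s (dilation e t x) = dilation e (s * t) x := by
  rw [dilation, inner_dilation he, perp_dilation he, dilation]
  simp only [real_smul_eq, smul_smul]
  congr 2 <;> push_cast <;> ring

lemma dilation_one (e x : Cn n) : dilation e 1 x = x := by
  simp [dilation, smul_add_perp]

lemma dilation_self {e : Cn n} (he : ‖e‖ = 1) (t : ℝ) : dilation e t e = (t ^ 2) • e := by
  simp [dilation, perp_self he, he]

lemma norm_dilation_le {e : Cn n} (he : ‖e‖ = 1) {t : ℝ} (ht : 0 ≤ t) (ht1 : t ≤ 1) (x : Cn n) :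
    ‖dilation e t x‖ ≤ t * ‖x‖ := by
  refine le_of_sq_le_sq ?_ (by positivity)
  rw [norm_sq_eq_add_perp he, inner_dilation he, perp_dilation he, norm_mul, norm_smul, norm_pow,
    Complex.norm_real, Real.norm_of_nonneg ht, mul_pow, mul_pow, mul_pow, norm_sq_eq_add_perp he x]
  have : t ^ 2 ≤ 1 := pow_le_one₀ ht ht1
  have h2 : (t ^ 2) ^ 2 ≤ t ^ 2 := by nlinarith [sq_nonneg t]
  nlinarith [mul_le_mul_of_nonneg_right h2 (sq_nonneg ‖inner ℂ e x‖)]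

lemma differentiable_dilation (e : Cn n) (t : ℝ) : Differentiable ℂ (dilation e t) := by
  have : dilation e t = fun x => ((t ^ 2 : ℝ) : ℂ) • (inner ℂ e x • e) + (t : ℂ) • perp e x := by
    funext x; rw [dilation, real_smul_eq, real_smul_eq]
  rw [this]
  exact (((differentiable_inner_unit e).smul_const e).const_smul ((t ^ 2 : ℝ) : ℂ)).add
    ((differentiable_perp e).const_smul (t : ℂ))

/-- Every term involving the component along `e` carries at least one more factor `t` than the
purely transversal one, so the rescaled form depends on `perp e x` alone in the limit. -/
lemma apply_dilation_sub_le {e : Cn n} (he : ‖e‖ = 1) {B : Cn n →L[ℝ] Cn n →L[ℝ] ℝ} {K : ℝ}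
    (hK : ‖B‖ ≤ K) {t : ℝ} (ht : 0 ≤ t) (ht1 : t ≤ 1) (x : Cn n) :
    |B (dilation e t x) (dilation e t x) - t ^ 2 * B (perp e x) (perp e x)| ≤
      t ^ 2 * (3 * K * t * ‖x‖ ^ 2) := by
  set X : Cn n := inner ℂ e x • e with hX
  set V := perp e x with hV
  have hXn : ‖X‖ ≤ ‖x‖ := by
    rw [hX, norm_smul, he, mul_one]; exact norm_inner_unit_le he x
  have hVn : ‖V‖ ≤ ‖x‖ := norm_perp_le he x
  have hK0 : 0 ≤ K := (norm_nonneg B).trans hK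
  have h1 : B (dilation e t x) (dilation e t x) - t ^ 2 * B V V =
      t ^ 2 * (t * (t * B X X + B X V + B V X)) := by
    rw [dilation]
    simp only [map_add, map_smul, add_apply, smul_apply,
      smul_eq_mul]
    ring
  have hb : ∀ Y Z : Cn n, ‖Y‖ ≤ ‖x‖ → ‖Z‖ ≤ ‖x‖ → |B Y Z| ≤ K * ‖x‖ ^ 2 := fun Y Z hY hZ => by
    refine (apply_le_of_norm_le hK Y Z).trans ?_
    rw [sq]; gcongr
  rw [h1, abs_mul, abs_mul, abs_of_nonneg ht, abs_of_nonneg (sq_nonneg t)]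
  have h2 : |t * B X X + B X V + B V X| ≤ 3 * (K * ‖x‖ ^ 2) := by
    have a1 : |t * B X X| ≤ K * ‖x‖ ^ 2 := by
      rw [abs_mul, abs_of_nonneg ht]
      have := hb X X hXn hXn
      nlinarith [abs_nonneg (B X X)]
    have a2 := abs_add_le (t * B X X + B X V) (B V X)
    have a3 := abs_add_le (t * B X X) (B X V)
    linarith [hb X V hXn hVn, hb V X hVn hXn]
  calc t ^ 2 * (t * |t * B X X + B X V + B V X|) ≤ t ^ 2 * (t * (3 * (K * ‖x‖ ^ 2))) := by gcongr
    _ = _ := by ring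

/-- Transport of an approximate ellipsoid map to a lower bound of the squeezing function. -/
lemma le_squeezingFunction_of_ellipsoid {e : Cn n} (he : ‖e‖ = 1) {N : Cn n → ℝ}
    (A : Cn n ≃ₗ[ℂ] Cn n) (hA : ∀ z, ‖A z‖ ^ 2 = N z) {ε : ℝ} (hε : 0 < ε) (hε1 : ε < 1)
    {Ω : Set (Cn n)} {q : Cn n} {F : Cn n → Cn n} (hd : DifferentiableOn ℂ F Ω)
    (hi : Set.InjOn F Ω) (hq : F q = 0) (h1 : ∀ x ∈ Ω, N (F x) < 1 + ε)
    (h2 : ∀ z, N z < 1 - ε → z ∈ F '' Ω) : 1 - ε ≤ squeezingFunction Ω q := by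
  set ρ : ℝ := Real.sqrt (1 + ε) with hρ
  have hρ2 : ρ ^ 2 = 1 + ε := Real.sq_sqrt (by linarith)
  have hρ0 : 0 < ρ := Real.sqrt_pos.2 (by linarith)
  have hρc : (ρ : ℂ) ≠ 0 := by exact_mod_cast hρ0.ne'
  refine le_squeezingFunction he (f := fun x => (ρ : ℂ)⁻¹ • A (F x)) (by linarith)
    ⟨?_, ?_, ?_, ?_⟩ ?_
  · exact (A.toContinuousLinearEquiv.differentiable.comp_differentiableOn hd).const_smul (ρ : ℂ)⁻¹
  · intro x hx y hy hxy
    exact hi hx hy (A.injective (smul_right_injective _ (inv_ne_zero hρc) hxy))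
  · intro x hx
    rw [mem_ball_zero_iff, norm_smul, norm_inv, Complex.norm_real, Real.norm_of_nonneg hρ0.le,
      inv_mul_lt_iff₀ hρ0, mul_one]
    refine lt_of_pow_lt_pow_left₀ 2 hρ0.le ?_
    rw [hA, hρ2]
    exact h1 x hx
  · simp [hq]
  · intro y hy
    rw [mem_ball_zero_iff] at hy
    -- Shrinking by `√(1 + ε)` costs nothing more than radius `1 - ε`, since `(1 + ε)(1 - ε)² ≤ 1 -
    -- ε`.
    obtain ⟨x, hx, hxz⟩ := h2 (A.symm ((ρ : ℂ) • y)) (by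
      rw [← hA, A.apply_symm_apply, norm_smul, Complex.norm_real, Real.norm_of_nonneg hρ0.le,
        mul_pow, hρ2]
      have : ‖y‖ ^ 2 < (1 - ε) ^ 2 := by gcongr
      nlinarith [sq_nonneg ε])
    refine ⟨x, hx, ?_⟩
    simp only [hxz, A.apply_symm_apply, smul_smul]
    rw [inv_mul_cancel₀ hρc, one_smul]

/-- A quantitative lower bound of the squeezing function along the inner normal `e` at a point `p`
where the domain is trapped between two osculating strictly convex quadrics. -/
theorem exists_le_squeezingFunction {c K ε : ℝ} (hc : 0 < c) (hcK : c ≤ 2 * K) (hε : 0 < ε)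
    (hε1 : ε < 1) (n : ℕ) : ∃ η > 0, ∀ r > 0, ∃ δ₀ > 0, ∀ (Ω : Set (Cn n)) (p e : Cn n)
      (B : Cn n →L[ℝ] Cn n →L[ℝ] ℝ), ‖e‖ = 1 → (∀ v w, B v w = B w v) → ‖B‖ ≤ K →
      (∀ v, c * ‖v‖ ^ 2 ≤ B v v) →
      (∀ w ∈ Ω, c * ‖w - p‖ ^ 2 ≤ (inner ℂ e (w - p)).re) →
      (∀ w ∈ Ω, ‖w - p‖ < r → B (w - p) (w - p) - η * ‖w - p‖ ^ 2 ≤ (inner ℂ e (w - p)).re) →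
      (∀ w, ‖w - p‖ < r → B (w - p) (w - p) + η * ‖w - p‖ ^ 2 < (inner ℂ e (w - p)).re → w ∈ Ω) →
      ∀ δ : ℝ, 0 < δ → δ < δ₀ → 1 - ε ≤ squeezingFunction Ω (p + δ • e) := by
  have hK : 0 < K := by linarith
  obtain ⟨κ, hκ, M, hM, hmain⟩ := exists_cayley_map (Cn n) hc hcK hε hε1.le
  -- On the ball of radius `M`, this `η` makes the trapping error at most half of `κ` after
  -- rescaling. The other half absorbs the mixed terms of `B`, through the bound on `t₀`.
  refine ⟨κ / (2 * M ^ 2), by positivity, fun r hr => ?_⟩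
  set t₀ : ℝ := min 1 (min (κ / (6 * K * M ^ 2)) (r / (2 * M))) with ht₀
  have ht₀0 : 0 < t₀ := by
    rw [ht₀]; positivity
  refine ⟨t₀ ^ 2, by positivity, fun Ω p e B he hB hBK hBc ha hb1 hb2 δ hδ0 hδ => ?_⟩
  -- The dilation with this parameter sends `e` to `δ • e`.
  set t : ℝ := Real.sqrt δ with ht
  have ht0 : 0 < t := Real.sqrt_pos.2 hδ0
  have htδ : t ^ 2 = δ := Real.sq_sqrt hδ0.le
  have htt₀ : t < t₀ := lt_of_pow_lt_pow_left₀ 2 ht₀0.le (by rw [htδ]; exact hδ)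
  have ht1 : t ≤ 1 := (htt₀.trans_le (min_le_left _ _)).le
  have ht2 : 3 * K * t * M ^ 2 ≤ κ / 2 := by
    have h := (htt₀.trans_le ((min_le_right _ _).trans (min_le_left _ _))).le
    rw [le_div_iff₀ (by positivity)] at h
    linarith
  have ht3 : t * M < r := by
    have h := (htt₀.trans_le ((min_le_right _ _).trans (min_le_right _ _))).le
    rw [le_div_iff₀ (by positivity)] at h
    linarith [mul_pos ht0 hM]
  have hinv : ∀ x, dilation e t⁻¹ (dilation e t x) = x := fun x => by
    rw [dilation_dilation he, inv_mul_cancel₀ ht0.ne', dilation_one]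
  have hinv' : ∀ x, dilation e t (dilation e t⁻¹ x) = x := fun x => by
    rw [dilation_dilation he, mul_inv_cancel₀ ht0.ne', dilation_one]
  have hre : ∀ x, (inner ℂ e (dilation e t x)).re = t ^ 2 * (inner ℂ e x).re := fun x => by
    rw [inner_dilation he, ← Complex.ofReal_pow, Complex.re_ofReal_mul]
  have ht2p : 0 < t ^ 2 := by positivity
  -- the error terms are small on the ball of radius `M`
  have herr : ∀ x, ‖x‖ ≤ M → ‖dilation e t x‖ < r ∧
      |B (dilation e t x) (dilation e t x) - t ^ 2 * B (perp e x) (perp e x)| ≤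
        t ^ 2 * (κ / 2) ∧ κ / (2 * M ^ 2) * ‖dilation e t x‖ ^ 2 ≤ t ^ 2 * (κ / 2) := by
    intro x hx
    have hn := norm_dilation_le he ht0.le ht1 x
    have hn2 : ‖dilation e t x‖ ≤ t * M := hn.trans (by gcongr)
    refine ⟨hn2.trans_lt ht3, ?_, ?_⟩
    · refine (apply_dilation_sub_le he hBK ht0.le ht1 x).trans ?_
      have : 3 * K * t * ‖x‖ ^ 2 ≤ 3 * K * t * M ^ 2 := by gcongr
      exact mul_le_mul_of_nonneg_left (this.trans ht2) ht2p.le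
    · calc _ ≤ κ / (2 * M ^ 2) * (t * M) ^ 2 := by gcongr
        _ = _ := by field_simp
  obtain ⟨A, hA⟩ := exists_linearEquiv_norm_sq hB hc hBc e
  obtain ⟨Φ, hΦd, hΦi, hΦe, hΦ1, hΦ2⟩ := hmain (hermPart B) (fun v => bilinPart B v v)
    (isLeviPair_of_bilin hB hBK hBc) e he {x | p + dilation e t x ∈ Ω}
    (fun x hx => by
      have h := ha _ hx
      rw [add_sub_cancel_left, hre] at h
      have h2 := norm_perp_le he (dilation e t x)
      rw [perp_dilation he, norm_smul, Complex.norm_real, Real.norm_of_nonneg ht0.le] at h2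
      have h3 : (t * ‖perp e x‖) ^ 2 ≤ ‖dilation e t x‖ ^ 2 := by gcongr
      refine le_of_mul_le_mul_left ?_ ht2p
      nlinarith)
    (fun x hx hxM => by
      obtain ⟨h1, h2, h3⟩ := herr x hxM
      have h := hb1 _ hx (by rwa [add_sub_cancel_left])
      rw [add_sub_cancel_left, hre] at h
      rw [hermPart_add_bilinPart_re]
      refine le_of_mul_le_mul_left ?_ ht2p
      linarith [(abs_le.1 h2).1])
    (fun x hxM hx => by
      obtain ⟨h1, h2, h3⟩ := herr x hxM
      rw [hermPart_add_bilinPart_re] at hx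
      refine hb2 _ (by rwa [add_sub_cancel_left]) ?_
      rw [add_sub_cancel_left, hre]
      have := mul_lt_mul_of_pos_left hx ht2p
      linarith [(abs_le.1 h2).2])
  have hmap : ∀ w ∈ Ω, dilation e t⁻¹ (w - p) ∈ {x | p + dilation e t x ∈ Ω} := fun w hw => by
    show p + dilation e t (dilation e t⁻¹ (w - p)) ∈ Ω
    rw [hinv', add_sub_cancel]; exact hw
  refine le_squeezingFunction_of_ellipsoid he A hA hε hε1
    (F := fun w => Φ (dilation e t⁻¹ (w - p))) ?_ ?_ ?_ ?_ ?_
  · exact hΦd.comp ((differentiable_dilation e t⁻¹).comp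
      (differentiable_id.sub_const p)).differentiableOn hmap
  · intro x hx y hy hxy
    have h := congrArg (dilation e t) (hΦi (hmap x hx) (hmap y hy) hxy)
    rw [hinv', hinv'] at h
    exact sub_left_injective h
  · simp only [add_sub_cancel_left]
    rw [← htδ, ← dilation_self he, hinv, hΦe]
  · exact fun x hx => hΦ1 _ (hmap x hx)
  · intro z hz
    obtain ⟨x, hx, hxz⟩ := hΦ2 z hz
    exact ⟨p + dilation e t x, hx, by simp only [add_sub_cancel_left, hinv, hxz]⟩

end Squeezing

/-! ### Real-variable tools: half-spaces, Taylor expansion, convexification. -/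

section Real

variable {E : Type*} [NormedAddCommGroup E] [NormedSpace ℝ E]

/-- Any `v` can be moved along `u` to have arbitrarily small positive `ℓ₁`-value, which yields `ℓ₂ u
* ℓ₁ v ≤ ℓ₂ v`; applying this to `-v` gives equality. -/
lemma LinearMap.eq_mul_of_halfSpace {V : Type*} [AddCommGroup V] [Module ℝ V]
    (ℓ₁ ℓ₂ : V →ₗ[ℝ] ℝ) {u : V} (hu : ℓ₁ u = 1) (h : ∀ v, 0 < ℓ₁ v → 0 ≤ ℓ₂ v) (v : V) :
    ℓ₂ v = ℓ₂ u * ℓ₁ v := by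
  have key : ∀ v, ℓ₂ u * ℓ₁ v ≤ ℓ₂ v := by
    intro v
    refine le_of_forall_pos_le_add fun ε hε => ?_
    have hu2 : 0 ≤ ℓ₂ u := h u (by rw [hu]; exact one_pos)
    have h1 := h (v + (ε / (ℓ₂ u + 1) - ℓ₁ v) • u) (by
      simp only [map_add, map_smul, smul_eq_mul, hu]
      have : 0 < ε / (ℓ₂ u + 1) := by positivity
      linarith)
    simp only [map_add, map_smul, smul_eq_mul] at h1
    have h2 : ε / (ℓ₂ u + 1) * ℓ₂ u ≤ ε := by
      rw [div_mul_eq_mul_div, div_le_iff₀ (by positivity)]; nlinarith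
    linarith
  have h1 := key v
  have h2 := key (-v)
  simp only [map_neg] at h2
  linarith

/-- Second order Taylor expansion with a uniform remainder around a point where the derivative is
strictly differentiable. -/
lemma exists_taylor_two {f : E → ℝ} {f' : E → E →L[ℝ] ℝ} {B : E →L[ℝ] E →L[ℝ] ℝ} {p : E}
    (hf : ∀ᶠ y in 𝓝 p, HasFDerivAt f (f' y) y) (hf' : HasStrictFDerivAt f' B p) {η : ℝ}
    (hη : 0 < η) : ∃ r > 0, ∀ x ∈ Metric.ball p r, ∀ y ∈ Metric.ball p r,
      |f y - f x - f' x (y - x) - B (y - x) (y - x) / 2| ≤ η * ‖y - x‖ ^ 2 := by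
  have hB := second_derivative_symmetric_of_eventually hf hf'.hasFDerivAt
  obtain ⟨r₁, hr₁, h1⟩ := Metric.eventually_nhds_iff_ball.1 hf
  have h2 := (hasStrictFDerivAt_iff_isLittleO.1 hf').bound hη
  obtain ⟨r₂, hr₂, h2⟩ := Metric.eventually_nhds_iff_ball.1 h2
  refine ⟨min r₁ r₂, by positivity, fun x hx y hy => ?_⟩
  -- The function is `f` minus its quadratic polynomial at `x` with the Hessian frozen at `p`.
  -- Strict differentiability of `f'` makes its derivative at most `η‖z - x‖`, and the closed ball
  -- keeps `‖z - x‖ ≤ ‖y - x‖` for the mean value inequality.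
  have hder : ∀ z ∈ Metric.ball p (min r₁ r₂) ∩ Metric.closedBall x ‖y - x‖,
      HasFDerivWithinAt (fun z => f z - f' x (z - x) - B (z - x) (z - x) / 2)
      (f' z - f' x - B (z - x)) (Metric.ball p (min r₁ r₂) ∩ Metric.closedBall x ‖y - x‖) z := by
    intro z hz
    have e1 := h1 z (Metric.ball_subset_ball (min_le_left _ _) hz.1)
    have e2 : HasFDerivAt (fun z => z - x) (ContinuousLinearMap.id ℝ E) z :=
      (hasFDerivAt_id z).sub_const x
    have e3 : HasFDerivAt (fun z => f' x (z - x)) (f' x) z := by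
      exact ((f' x).hasFDerivAt.comp z e2).congr_fderiv (by ext; simp)
    have e4 : HasFDerivAt (fun z => B (z - x)) B z := by
      exact (B.hasFDerivAt.comp z e2).congr_fderiv (by ext; simp)
    have e5 := ((e4.clm_apply e2).mul_const (1 / 2 : ℝ))
    refine (((e1.sub e3).sub e5).congr_fderiv ?_).hasFDerivWithinAt.congr_of_eventuallyEq ?_ ?_
    · ext v
      simp [hB v z, hB v x]
      ring
    · exact Eventually.of_forall fun w => by simp [div_eq_mul_inv]
    · simp [div_eq_mul_inv]
  have hbd : ∀ z ∈ Metric.ball p (min r₁ r₂) ∩ Metric.closedBall x ‖y - x‖,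
      ‖f' z - f' x - B (z - x)‖ ≤ η * ‖y - x‖ := by
    intro z hz
    have hmem : (z, x) ∈ Metric.ball (p, p) r₂ := by
      rw [← ball_prod_same]
      exact ⟨Metric.ball_subset_ball (min_le_right _ _) hz.1,
        Metric.ball_subset_ball (min_le_right _ _) hx⟩
    refine (h2 _ hmem).trans ?_
    have : ‖z - x‖ ≤ ‖y - x‖ := by simpa [dist_eq_norm] using hz.2
    simp only
    gcongr
  have h := ((convex_ball p (min r₁ r₂)).inter
    (convex_closedBall x ‖y - x‖)).norm_image_sub_le_of_norm_hasFDerivWithin_le hder hbd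
    (x := x) (y := y) ⟨hx, by simp⟩ ⟨hy, by simp [dist_eq_norm]⟩
  simp only [sub_self, map_zero, zero_div, sub_zero, Real.norm_eq_abs] at h
  rw [sq, ← mul_assoc]
  convert h using 2
  ring

/-- A quadratic form that is positive on a hyperplane becomes positive definite after adding a
multiple of the square of the linear form. -/
lemma exists_pos_def_add_sq {B : E →L[ℝ] E →L[ℝ] ℝ} (hB : ∀ v w, B v w = B w v) {ℓ : E →L[ℝ] ℝ}
    {u : E} (hu : ℓ u = 1) {m : ℝ} (hm : 0 < m) (h : ∀ v, ℓ v = 0 → m * ‖v‖ ^ 2 ≤ B v v) :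
    ∃ K : ℝ, ∀ x, m / 4 * ‖x‖ ^ 2 ≤ B x x + K * ℓ x ^ 2 := by
  -- The summands absorb, in order, the mixed term by Young's inequality, the term `B u u`, and the
  -- part of `‖x‖²` along `u`.
  refine ⟨2 * (‖B‖ * ‖u‖) ^ 2 / m + ‖B‖ * ‖u‖ ^ 2 + m / 2 * ‖u‖ ^ 2, fun x => ?_⟩
  set s := ℓ x with hs
  set v := x - s • u with hv
  have hx : x = v + s • u := by simp [hv]
  have h1 := h v (by simp [hv, hu, hs])
  have h2 : B x x = B v v + 2 * s * B v u + s ^ 2 * B u u := by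
    rw [hx]
    simp only [map_add, map_smul, add_apply, smul_apply, smul_eq_mul, hB u v]
    ring
  have h3 : ‖x‖ ^ 2 ≤ 2 * ‖v‖ ^ 2 + 2 * s ^ 2 * ‖u‖ ^ 2 := by
    have : ‖x‖ ≤ ‖v‖ + |s| * ‖u‖ := by
      conv_lhs => rw [hx]
      refine (norm_add_le _ _).trans ?_
      rw [norm_smul, Real.norm_eq_abs]
    have h4 : ‖x‖ ^ 2 ≤ (‖v‖ + |s| * ‖u‖) ^ 2 := by gcongr
    have h5 : (|s| * ‖u‖) ^ 2 = s ^ 2 * ‖u‖ ^ 2 := by rw [mul_pow, sq_abs]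
    nlinarith [sq_nonneg (‖v‖ - |s| * ‖u‖)]
  have h4 : |B v u| ≤ ‖B‖ * ‖u‖ * ‖v‖ := by
    have := B.le_opNorm₂ v u
    rw [Real.norm_eq_abs] at this
    linarith
  have h5 : |B u u| ≤ ‖B‖ * ‖u‖ ^ 2 := by
    have := B.le_opNorm₂ u u
    rw [Real.norm_eq_abs] at this
    rw [sq]; linarith
  have h6 : -(m / 2 * ‖v‖ ^ 2 + 2 * (‖B‖ * ‖u‖) ^ 2 / m * s ^ 2) ≤ 2 * s * B v u := by
    have e1 : |2 * s * B v u| ≤ 2 * |s| * (‖B‖ * ‖u‖ * ‖v‖) := by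
      rw [abs_mul, abs_mul, abs_two]; gcongr
    have e2 := (abs_le.1 e1).1
    have e3 : 0 ≤ m / 2 * (‖v‖ - 2 * (‖B‖ * ‖u‖) * |s| / m) ^ 2 := by positivity
    have e4 : m / 2 * (‖v‖ - 2 * (‖B‖ * ‖u‖) * |s| / m) ^ 2 = m / 2 * ‖v‖ ^ 2 +
        2 * (‖B‖ * ‖u‖) ^ 2 / m * s ^ 2 - 2 * |s| * (‖B‖ * ‖u‖ * ‖v‖) := by
      rw [← sq_abs s]; field_simp; ring
    linarith
  have h7 : -(‖B‖ * ‖u‖ ^ 2 * s ^ 2) ≤ s ^ 2 * B u u := by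
    have := mul_le_mul_of_nonneg_left (abs_le.1 h5).1 (sq_nonneg s)
    linarith
  rw [h2]
  nlinarith

end Real

/-! ### Contact with the enclosing sphere. -/

section Tangency

variable {n : ℕ}

/-- The real part of the inner product with `e`, as a real linear form. -/
noncomputable def reInner (e : Cn n) : Cn n →ₗ[ℝ] ℝ where
  toFun v := (inner ℂ e v).re
  map_add' v w := by rw [inner_add_right, Complex.add_re]
  map_smul' r v := by
    rw [real_smul_eq, inner_smul_right, Complex.re_ofReal_mul]; rfl

lemma reInner_apply (e v : Cn n) : reInner e v = (inner ℂ e v).re := rfl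

lemma norm_add_sq_reInner (a b : Cn n) : ‖a + b‖ ^ 2 = ‖a‖ ^ 2 + 2 * reInner a b + ‖b‖ ^ 2 :=
  norm_add_sq (𝕜 := ℂ) a b

lemma reInner_lt_of_ball {Ω : Set (Cn n)} {p c : Cn n} {R : ℝ} (hΩ : Ω ⊆ Metric.ball c R)
    (hp : p ∈ Metric.sphere c R) {x : Cn n} (hx : p + x ∈ Ω) :
    2 * reInner (p - c) x + ‖x‖ ^ 2 < 0 := by
  have h1 := hΩ hx
  rw [mem_ball_iff_norm, add_sub_right_comm] at h1
  have h2 : ‖p - c‖ = R := by rwa [mem_sphere_iff_norm] at hp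
  have h3 : ‖p - c + x‖ ^ 2 < R ^ 2 := by gcongr
  rw [norm_add_sq_reInner, h2] at h3
  linarith

/-- At a boundary point lying on a sphere that encloses the domain, the conormals agree and the
domain is at least as curved as the sphere. -/
lemma exists_tangency {Ω : Set (Cn n)} {p c : Cn n} {R : ℝ} (hΩ : Ω ⊆ Metric.ball c R)
    (hp : p ∈ Metric.sphere c R) {f : Cn n → ℝ} {f' : Cn n → Cn n →L[ℝ] ℝ}
    {B : Cn n →L[ℝ] Cn n →L[ℝ] ℝ} (hf : ∀ᶠ y in 𝓝 p, HasFDerivAt f (f' y) y)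
    (hf' : HasStrictFDerivAt f' B p) (hfp : f p = 0) (hne : f' p ≠ 0)
    (hfΩ : ∀ᶠ z in 𝓝 p, f z < 0 → z ∈ Ω) :
    ∃ μ > 0, (∀ v, 2 * reInner (p - c) v = μ * f' p v) ∧
      ∀ v, f' p v = 0 → 2 * ‖v‖ ^ 2 ≤ μ * B v v := by
  have hB := second_derivative_symmetric_of_eventually hf hf'.hasFDerivAt
  obtain ⟨u, hu⟩ : ∃ u, f' p u = -1 := by
    obtain ⟨w, hw⟩ := ContinuousLinearMap.exists_ne_zero hne
    exact ⟨-(f' p w)⁻¹ • w, by simp [hw]⟩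
  -- a second order curve along which `f` decreases stays in the domain
  have key : ∀ (v : Cn n) (b : ℝ), f' p v = 0 → B v v / 2 < b →
      ∀ᶠ t : ℝ in 𝓝[>] 0, p + t • (v + (t * b) • u) ∈ Ω := by
    intro v b hv hb
    set G : ℝ := ‖v‖ + |b| * ‖u‖ with hG
    have hG0 : 0 ≤ G := by positivity
    -- Half of the gap `b - B v v / 2` pays for the Taylor remainder, the other half for the
    -- higher-order terms in `t`.
    set η : ℝ := (b - B v v / 2) / (2 * (G ^ 2 + 1)) with hη
    have hη0 : 0 < η := by
      have : 0 < b - B v v / 2 := by linarith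
      positivity
    obtain ⟨r, hr, htay⟩ := exists_taylor_two hf hf' hη0
    have hcurve : Tendsto (fun t : ℝ => p + t • (v + (t * b) • u)) (𝓝[>] 0) (𝓝 p) := by
      have : Continuous (fun t : ℝ => p + t • (v + (t * b) • u)) := by fun_prop
      have h := this.tendsto 0
      simp only [zero_smul, add_zero] at h
      exact h.mono_left nhdsWithin_le_nhds
    have hpoly : ∀ᶠ t : ℝ in 𝓝[>] 0, t * b * B v u + t ^ 2 * b ^ 2 / 2 * B u u <
        (b - B v v / 2) / 2 := by
      have : Continuous (fun t : ℝ => t * b * B v u + t ^ 2 * b ^ 2 / 2 * B u u) := by fun_prop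
      have h := this.tendsto 0
      refine (h.mono_left nhdsWithin_le_nhds).eventually_lt_const ?_
      norm_num
      linarith
    have ht1 : ∀ᶠ t : ℝ in 𝓝[>] 0, t < 1 :=
      nhdsWithin_le_nhds (eventually_lt_nhds one_pos)
    filter_upwards [hcurve.eventually hfΩ, hcurve.eventually (Metric.ball_mem_nhds p hr), hpoly,
      ht1, self_mem_nhdsWithin] with t h1 h2 h3 h4 h5
    have ht : 0 < t := h5
    apply h1
    have hT := (abs_le.1 (htay p (Metric.mem_ball_self hr) _ h2)).2
    rw [hfp, add_sub_cancel_left] at hT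
    have e1 : f' p (t • (v + (t * b) • u)) = -(t ^ 2 * b) := by
      simp only [map_add, map_smul, smul_eq_mul, hv, hu]; ring
    have e2 : B (t • (v + (t * b) • u)) (t • (v + (t * b) • u)) =
        t ^ 2 * (B v v + 2 * (t * b * B v u + t ^ 2 * b ^ 2 / 2 * B u u)) := by
      simp only [map_add, map_smul, add_apply, smul_apply, smul_eq_mul, hB u v]; ring
    have e3 : ‖t • (v + (t * b) • u)‖ ≤ t * G := by
      rw [norm_smul, Real.norm_of_nonneg ht.le]
      gcongr
      refine (norm_add_le _ _).trans ?_
      rw [norm_smul, Real.norm_eq_abs, abs_mul, abs_of_pos ht, hG]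
      have : 0 ≤ |b| * ‖u‖ := by positivity
      nlinarith
    have e4 : η * ‖t • (v + (t * b) • u)‖ ^ 2 ≤ t ^ 2 * ((b - B v v / 2) / 2) := by
      calc _ ≤ η * (t * G) ^ 2 := by gcongr
        _ = t ^ 2 * (η * G ^ 2) := by ring
        _ ≤ t ^ 2 * (η * (G ^ 2 + 1)) := by gcongr; linarith
        _ = _ := by rw [hη]; field_simp
    rw [e1, e2] at hT
    have e5 := mul_lt_mul_of_pos_left h3 (pow_pos ht 2)
    linarith
  have hfirst : ∀ v, f' p v < 0 → reInner (p - c) v < 0 := by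
    intro v hv
    have hder : HasDerivAt (fun t : ℝ => f (p + t • v)) (f' p v) 0 := by
      have h1 : HasDerivAt (fun t : ℝ => p + t • v) v 0 := by
        simpa using ((hasDerivAt_id (0 : ℝ)).smul_const v).const_add p
      have h2 : HasFDerivAt f (f' p) (p + (0 : ℝ) • v) := by simpa using hf.self_of_nhds
      exact h2.comp_hasDerivAt 0 h1
    have hcurve : Tendsto (fun t : ℝ => p + t • v) (𝓝[>] 0) (𝓝 p) := by
      have : Continuous (fun t : ℝ => p + t • v) := by fun_prop
      have h := this.tendsto 0
      simp only [zero_smul, add_zero] at h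
      exact h.mono_left nhdsWithin_le_nhds
    have hslope := (hasDerivAt_iff_tendsto_slope.1 hder).mono_left
      (nhdsWithin_mono 0 (s := Set.Ioi 0) fun t (ht : 0 < t) => ht.ne')
    have hev : ∀ᶠ t : ℝ in 𝓝[>] 0, p + t • v ∈ Ω ∧ 0 < t := by
      filter_upwards [hslope.eventually_lt_const hv, hcurve.eventually hfΩ, self_mem_nhdsWithin]
        with t h1 h2 h3
      have ht : 0 < t := h3
      refine ⟨h2 ?_, ht⟩
      rw [slope_def_field] at h1
      simp only [zero_smul, add_zero, hfp, sub_zero] at h1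
      rwa [div_lt_iff₀ ht, zero_mul] at h1
    obtain ⟨t, h1, ht⟩ := hev.exists
    have h2 := reInner_lt_of_ball hΩ hp h1
    rw [map_smul, smul_eq_mul] at h2
    have : t * reInner (p - c) v < 0 := by nlinarith [sq_nonneg ‖t • v‖]
    by_contra! hge
    linarith [mul_nonneg ht.le hge]
  have hμ := hfirst u (by rw [hu]; norm_num)
  have hprop : ∀ v, 2 * reInner (p - c) v = -(2 * reInner (p - c) u) * f' p v := by
    intro v
    have h := LinearMap.eq_mul_of_halfSpace (-(f' p : Cn n →ₗ[ℝ] ℝ)) (-((2 : ℝ) • reInner (p - c)))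
      (u := u) (by simp [hu]) (fun v hv => by
        have := hfirst v (by simpa using hv)
        simp only [LinearMap.neg_apply, LinearMap.smul_apply, smul_eq_mul]
        linarith) v
    simp only [LinearMap.neg_apply, LinearMap.smul_apply, smul_eq_mul,
      ContinuousLinearMap.coe_coe] at h
    linarith
  refine ⟨-(2 * reInner (p - c) u), by linarith, hprop, fun v hv => ?_⟩
  set μ : ℝ := -(2 * reInner (p - c) u) with hμ_def
  have hμ0 : 0 < μ := by linarith
  refine le_of_forall_pos_le_add fun ε hε => ?_
  set b : ℝ := B v v / 2 + ε / (2 * μ) with hb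
  have hev := key v b hv (by
    have : 0 < ε / (2 * μ) := by positivity
    linarith)
  have hlim : Tendsto (fun t : ℝ => ‖v + (t * b) • u‖ ^ 2) (𝓝[>] 0) (𝓝 (‖v‖ ^ 2)) := by
    have : Continuous (fun t : ℝ => ‖v + (t * b) • u‖ ^ 2) := by fun_prop
    have h := this.tendsto 0
    simp only [zero_mul, zero_smul, add_zero] at h
    exact h.mono_left nhdsWithin_le_nhds
  -- Along the curve the linear term of the ball inequality is exactly `-μ t² b`, so dividing by
  -- `t²` and letting `t → 0` compares the two curvatures.
  have hle : ‖v‖ ^ 2 ≤ μ * b := by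
    refine le_of_tendsto hlim ?_
    filter_upwards [hev, self_mem_nhdsWithin] with t h1 h2
    have ht : 0 < t := h2
    have h3 := reInner_lt_of_ball hΩ hp h1
    rw [hprop, norm_smul, Real.norm_of_nonneg ht.le, mul_pow] at h3
    simp only [map_add, map_smul, smul_eq_mul, hv, hu] at h3
    have h4 : t ^ 2 * ‖v + (t * b) • u‖ ^ 2 < t ^ 2 * (μ * b) := by linarith
    exact (lt_of_mul_lt_mul_left h4 (by positivity)).le
  have : μ * b = μ * (B v v / 2) + ε / 2 := by rw [hb]; field_simp
  linarith

/-- Near a spherically extreme point the domain has a strictly convex defining function. -/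
lemma IsSphericallyExtreme.exists_defining_function {Ω : Set (Cn n)} {p : Cn n} (hΩ : IsOpen Ω)
    (h : IsSphericallyExtreme Ω p) :
    ∃ (f : Cn n → ℝ) (f' : Cn n → Cn n →L[ℝ] ℝ) (B : Cn n →L[ℝ] Cn n →L[ℝ] ℝ) (c : Cn n)
      (R μ m : ℝ), 0 < R ∧ 0 < μ ∧ 0 < m ∧ (∀ᶠ y in 𝓝 p, HasFDerivAt f (f' y) y) ∧
      HasStrictFDerivAt f' B p ∧ f' p ≠ 0 ∧ (∀ᶠ z in 𝓝 p, z ∈ Ω ↔ f z < 0) ∧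
      (∀ v, m * ‖v‖ ^ 2 ≤ B v v) ∧ Ω ⊆ Metric.ball c R ∧ p ∈ Metric.sphere c R ∧
      ∀ v, 2 * reInner (p - c) v = μ * f' p v := by
  obtain ⟨hfr, ⟨U, ρ, hU, hpU, hρ, hdρ, hΩU⟩, c, R, hR, hball, hsph⟩ := h
  have hU' : U ∈ 𝓝 p := hU.mem_nhds hpU
  have hc2 : ContDiffAt ℝ 2 ρ p := hρ.contDiffAt hU'
  have hev : ∀ᶠ y in 𝓝 p, HasFDerivAt ρ (fderiv ℝ ρ y) y := by
    filter_upwards [hU'] with y hy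
    have hmem : U ∈ 𝓝 y := hU.mem_nhds hy
    exact ((hρ.contDiffAt hmem).differentiableAt (by norm_num)).hasFDerivAt
  have hstr1 : HasStrictFDerivAt ρ (fderiv ℝ ρ p) p := hc2.hasStrictFDerivAt (by norm_num)
  have hstr : HasStrictFDerivAt (fderiv ℝ ρ) (fderiv ℝ (fderiv ℝ ρ) p) p :=
    (hc2.fderiv_right (m := 1) (by norm_num)).hasStrictFDerivAt (by norm_num)
  set B := fderiv ℝ (fderiv ℝ ρ) p with hB_def
  have hiff : ∀ z ∈ U, z ∈ Ω ↔ ρ z < 0 := fun z hz => by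
    have : z ∈ Ω ∩ U ↔ z ∈ {z ∈ U | ρ z < 0} := by rw [hΩU]
    simpa [hz] using this
  have hρc : ContinuousAt ρ p := hc2.continuousAt
  have hp0 : ρ p = 0 := by
    refine le_antisymm ?_ ?_
    · by_contra! hlt
      have h1 : ∀ᶠ z in 𝓝 p, 0 < ρ z ∧ z ∈ U := (hρc.eventually_const_lt hlt).and hU'
      obtain ⟨z, hz, hzΩ⟩ := mem_closure_iff_nhds.1 hfr.1 _ h1
      exact absurd ((hiff z hz.2).1 hzΩ) (not_lt.2 hz.1.le)
    · have : p ∉ Ω := fun hp => hfr.2 (by rwa [hΩ.interior_eq])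
      rw [hiff p hpU] at this
      exact not_lt.1 this
  have hdp := hdρ p hpU
  have hB := second_derivative_symmetric_of_eventually hev hstr.hasFDerivAt
  obtain ⟨μ, hμ, hμ1, hμ2⟩ := exists_tangency hball hsph hev hstr hp0 hdp
    (by filter_upwards [hU'] with z hz using (hiff z hz).2)
  obtain ⟨u, hu⟩ : ∃ u, fderiv ℝ ρ p u = 1 := by
    obtain ⟨w, hw⟩ := ContinuousLinearMap.exists_ne_zero hdp
    exact ⟨(fderiv ℝ ρ p w)⁻¹ • w, by simp [hw]⟩
  obtain ⟨K, hK⟩ := exists_pos_def_add_sq hB hu (m := 2 / μ) (by positivity) (fun v hv => by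
    rw [div_mul_eq_mul_div, div_le_iff₀ hμ]; linarith [hμ2 v hv])
  -- Since `ρ p = 0`, the added square leaves the derivative at `p` unchanged and adds `K dρ ⊗ dρ`
  -- to the Hessian. Near `p` the factor `1 + K/2 ρ` is positive, so the sign is that of `ρ`.
  refine ⟨fun z => ρ z + K / 2 * ρ z ^ 2, fun z => (1 + K * ρ z) • fderiv ℝ ρ z,
    B + (K • fderiv ℝ ρ p).smulRight (fderiv ℝ ρ p), c, R, μ, 2 / μ / 4, hR, hμ, by positivity,
    ?_, ?_, ?_, ?_, ?_, hball, hsph, ?_⟩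
  · filter_upwards [hev] with y hy
    refine (hy.add ((hy.pow 2).const_mul (K / 2))).congr_fderiv ?_
    ext v
    simp
    ring
  · refine (((hstr1.const_mul K).const_add 1).smul hstr).congr_fderiv ?_
    simp [hp0]
  · simpa [hp0] using hdp
  · have h1 : Tendsto (fun z => 1 + K / 2 * ρ z) (𝓝 p) (𝓝 (1 + K / 2 * ρ p)) :=
      (hρc.const_mul _).const_add 1
    have h2 := h1.eventually_const_lt (u := 0) (by rw [hp0]; norm_num)
    filter_upwards [h2, hU'] with z hz hzU
    rw [hiff z hzU]
    have : ρ z + K / 2 * ρ z ^ 2 = ρ z * (1 + K / 2 * ρ z) := by ring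
    rw [this]
    exact ⟨fun h => mul_neg_of_neg_of_pos h hz, fun h => neg_of_mul_neg_left h hz.le⟩
  · intro v
    have := hK v
    simp only [add_apply, ContinuousLinearMap.smulRight_apply, smul_apply, smul_eq_mul]
    linarith
  · intro v
    simp [hp0, hμ1 v]

end Tangency

/-! ### Nearest boundary points and uniform constants. -/

section Approach

variable {n : ℕ}

/-- A point of an open set lies on the inner normal ray from its nearest boundary point, when the
set has a locally convex defining function. -/
lemma exists_nearest_boundary_point {Ω : Set (Cn n)} (hΩ : IsOpen Ω) {p : Cn n} (hp : p ∉ Ω)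
    {f : Cn n → ℝ} {f' : Cn n → Cn n →L[ℝ] ℝ} {r : ℝ}
    (hf : ∀ x ∈ Metric.ball p r, HasFDerivAt f (f' x) x)
    (hconv : ∀ x ∈ Metric.ball p r, ∀ y ∈ Metric.ball p r, f x + f' x (y - x) ≤ f y)
    (hiff : ∀ x ∈ Metric.ball p r, x ∈ Ω ↔ f x < 0) {q : Cn n} (hq : q ∈ Ω)
    (hqr : 2 * dist q p < r) :
    ∃ (b e : Cn n) (δ : ℝ), 0 < δ ∧ δ ≤ dist q p ∧ dist b p ≤ 2 * dist q p ∧ ‖e‖ = 1 ∧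
      q = b + δ • e ∧ f b = 0 ∧ ∀ v, f' b v = f' b e * reInner e v := by
  obtain ⟨b, hb, hbd⟩ := hΩ.isClosed_compl.exists_infDist_eq_dist ⟨p, hp⟩ q
  have hmin : ∀ x, dist q x < dist q b → x ∈ Ω := fun x hx => by
    by_contra hxΩ
    have := Metric.infDist_le_dist_of_mem (x := q) (s := Ωᶜ) hxΩ
    linarith
  have hδ : 0 < dist q b := dist_pos.2 fun h => hb (h ▸ hq)
  have hδle : dist q b ≤ dist q p := hbd ▸ Metric.infDist_le_dist_of_mem (s := Ωᶜ) hp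
  have hbp : dist b p ≤ 2 * dist q p := by
    have := dist_triangle_left b p q
    linarith
  set δ := dist q b with hδ_def
  set e : Cn n := δ⁻¹ • (q - b) with he_def
  have he : ‖e‖ = 1 := by
    rw [he_def, norm_smul, norm_inv, Real.norm_of_nonneg hδ.le, ← dist_eq_norm, ← hδ_def,
      inv_mul_cancel₀ hδ.ne']
  have hqe : δ • e = q - b := by rw [he_def, smul_smul, mul_inv_cancel₀ hδ.ne', one_smul]
  have hbr : b ∈ Metric.ball p r := by
    rw [Metric.mem_ball]; linarith
  have hee : reInner e e = 1 := by
    rw [reInner_apply, inner_self_eq_norm_sq_to_K, he]; simp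
  -- inward directions enter the ball around `q`
  have hin : ∀ v, 0 < reInner e v → ∀ᶠ s : ℝ in 𝓝[>] 0, b + s • v ∈ Ω := by
    intro v hv
    have h1 : ∀ᶠ s : ℝ in 𝓝[>] 0, s * ‖v‖ ^ 2 < 2 * (δ * reInner e v) := by
      have : Continuous (fun s : ℝ => s * ‖v‖ ^ 2) := by fun_prop
      have h := (this.tendsto 0).mono_left (nhdsWithin_le_nhds (s := Set.Ioi 0))
      refine h.eventually_lt_const ?_
      rw [zero_mul]
      positivity
    filter_upwards [h1, self_mem_nhdsWithin] with s hs hs0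
    have hs0' : 0 < s := hs0
    apply hmin
    rw [dist_comm, dist_eq_norm]
    refine lt_of_pow_lt_pow_left₀ 2 hδ.le ?_
    have e1 : b + s • v - q = -(δ • e) + s • v := by rw [hqe]; abel
    have e2 : reInner (-(δ • e)) (s • v) = -(δ * s * reInner e v) := by
      rw [map_smul, reInner_apply, real_smul_eq, inner_neg_left, inner_smul_left, Complex.conj_ofReal,
        Complex.neg_re, Complex.re_ofReal_mul, reInner_apply, smul_eq_mul]
      ring
    have e3 : ‖δ • e‖ = δ := by rw [norm_smul, he, mul_one, Real.norm_of_nonneg hδ.le]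
    rw [e1, norm_add_sq_reInner, e2, norm_neg, e3, norm_smul, Real.norm_of_nonneg hs0'.le]
    nlinarith
  have hcurve : ∀ v : Cn n, Tendsto (fun s : ℝ => b + s • v) (𝓝[>] 0) (𝓝 b) := fun v => by
    have : Continuous (fun s : ℝ => b + s • v) := by fun_prop
    have h := this.tendsto 0
    simp only [zero_smul, add_zero] at h
    exact h.mono_left nhdsWithin_le_nhds
  have hneg : ∀ v, 0 < reInner e v → ∀ᶠ s : ℝ in 𝓝[>] 0,
      0 < s ∧ b + s • v ∈ Metric.ball p r ∧ f (b + s • v) < 0 := by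
    intro v hv
    filter_upwards [hin v hv, (hcurve v).eventually (Metric.isOpen_ball.mem_nhds hbr),
      self_mem_nhdsWithin] with s h1 h2 h3
    exact ⟨h3, h2, (hiff _ h2).1 h1⟩
  have hfb : f b = 0 := by
    refine le_antisymm ?_ (not_lt.1 fun h => hb ((hiff b hbr).2 h))
    have h1 : Tendsto (fun s : ℝ => f (b + s • e)) (𝓝[>] 0) (𝓝 (f b)) :=
      (hf b hbr).continuousAt.tendsto.comp (hcurve e)
    exact le_of_tendsto h1 ((hneg e (by rw [hee]; exact one_pos)).mono fun s h => h.2.2.le)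
  refine ⟨b, e, δ, hδ, hδle, hbp, he, by rw [hqe]; abel, hfb, fun v => ?_⟩
  -- Convexity turns `f (b + s • v) < 0 = f b` into `f' b v ≤ 0` for every inward `v`, so the
  -- derivative is a multiple of `reInner e`.
  have h := LinearMap.eq_mul_of_halfSpace (reInner e) (-(f' b : Cn n →ₗ[ℝ] ℝ)) hee (fun v hv => by
    obtain ⟨s, hs, hsr, hs1⟩ := (hneg v hv).exists
    have h1 := hconv b hbr _ hsr
    rw [hfb, add_sub_cancel_left, map_smul, smul_eq_mul] at h1
    have h2 : f' b v ≤ 0 := by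
      by_contra! hpos
      linarith [mul_pos hs hpos]
    simpa using h2) v
  simp only [LinearMap.neg_apply, ContinuousLinearMap.coe_coe] at h
  linarith

set_option maxHeartbeats 1000000 in
/-- A lower bound on the squeezing function near a spherically extreme boundary point. -/
lemma eventually_le_squeezingFunction {Ω : Set (Cn n)} (hΩ : IsOpen Ω) {p : Cn n}
    (h : IsSphericallyExtreme Ω p) {ε : ℝ} (hε : 0 < ε) (hε1 : ε < 1) :
    ∀ᶠ q in 𝓝[Ω] p, 1 - ε ≤ squeezingFunction Ω q := by
  have hpΩ : p ∉ Ω := fun hp => h.1.2 (by rwa [hΩ.interior_eq])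
  obtain ⟨f, f', B, c, R, μ, m, hR, hμ, hm, hf, hf', hdp, hiff, hBm, hball, hsph, hgrad⟩ :=
    h.exists_defining_function hΩ
  have hB := second_derivative_symmetric_of_eventually hf hf'.hasFDerivAt
  set Λ : ℝ := ‖f' p‖ with hΛ
  have hΛ0 : 0 < Λ := norm_pos_iff.2 hdp
  obtain ⟨r₁, hr₁, h1⟩ := exists_taylor_two hf hf' (η := m / 4) (by positivity)
  obtain ⟨r₂, hr₂, h2⟩ := Metric.eventually_nhds_iff_ball.1 (hf.and hiff)
  set r₀ : ℝ := min r₁ r₂ with hr₀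
  have hr₀0 : 0 < r₀ := by positivity
  have hr01 : Metric.ball p r₀ ⊆ Metric.ball p r₁ := Metric.ball_subset_ball (min_le_left _ _)
  have hr02 : Metric.ball p r₀ ⊆ Metric.ball p r₂ := Metric.ball_subset_ball (min_le_right _ _)
  have hconv : ∀ x ∈ Metric.ball p r₀, ∀ y ∈ Metric.ball p r₀,
      f x + f' x (y - x) + m / 4 * ‖y - x‖ ^ 2 ≤ f y := fun x hx y hy => by
    have a1 := (abs_le.1 (h1 x (hr01 hx) y (hr01 hy))).1
    have a2 := hBm (y - x)
    linarith
  set K : ℝ := ‖B‖ / Λ + m / Λ with hK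
  -- The first entry comes from strict convexity within distance `r₀` of `p`, the second from the
  -- enclosing ball beyond it.
  set κ : ℝ := min (m / (6 * Λ)) (r₀ ^ 2 / (4 * μ * Λ * (2 * R + 1) ^ 2)) with hκ
  have hκ0 : 0 < κ := by positivity
  have hκm : κ ≤ m / (6 * Λ) := min_le_left _ _
  have hκK : κ ≤ 2 * K := by
    refine hκm.trans ?_
    have e1 : m / (6 * Λ) ≤ m / Λ := by gcongr; linarith
    have e2 : 0 ≤ ‖B‖ / Λ := by positivity
    have e3 : 0 < m / Λ := by positivity
    linarith
  obtain ⟨η, hη, hsq⟩ := exists_le_squeezingFunction hκ0 hκK hε hε1 n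
  obtain ⟨r₃, hr₃, h3⟩ := exists_taylor_two hf hf' (η := η * Λ / 4) (by positivity)
  set r : ℝ := min r₀ r₃ / 2 with hr
  have hr_pos : 0 < r := by positivity
  obtain ⟨δ₀, hδ₀, hsq⟩ := hsq r hr_pos
  -- closeness of the conormal at nearby points
  set τ : ℝ := min (Λ / 2) (r₀ ^ 2 / (4 * μ * (2 * R + 1))) with hτ
  have hτ0 : 0 < τ := by positivity
  have hcont : ∀ᶠ b in 𝓝 p, ‖f' b - f' p‖ < τ := by
    have := hf'.hasFDerivAt.continuousAt
    have h4 := Metric.tendsto_nhds.1 this τ hτ0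
    simpa [dist_eq_norm] using h4
  obtain ⟨r₄, hr₄, h4⟩ := Metric.eventually_nhds_iff_ball.1 hcont
  set d : ℝ := min (min r r₄) (min (min 1 δ₀) (r₀ ^ 2 / (4 * μ * Λ))) / 2 with hd
  have hd0 : 0 < d := by positivity
  have hd1 : 2 * d ≤ r ∧ 2 * d ≤ r₄ ∧ 2 * d ≤ 1 ∧ 2 * d ≤ δ₀ ∧
      2 * d ≤ r₀ ^ 2 / (4 * μ * Λ) := by
    have e : 2 * d = min (min r r₄) (min (min 1 δ₀) (r₀ ^ 2 / (4 * μ * Λ))) := by rw [hd]; ring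
    rw [e]
    simp
  obtain ⟨hdr, hdr4, hd1, hdδ, hdg⟩ := hd1
  have hrr0 : 2 * r ≤ r₀ := by
    have : 2 * r = min r₀ r₃ := by rw [hr]; ring
    rw [this]; exact min_le_left _ _
  have hrr3 : 2 * r ≤ r₃ := by
    have : 2 * r = min r₀ r₃ := by rw [hr]; ring
    rw [this]; exact min_le_right _ _
  filter_upwards [self_mem_nhdsWithin, nhdsWithin_le_nhds (Metric.ball_mem_nhds p hd0)]
    with q hqΩ hqd
  rw [Metric.mem_ball] at hqd
  obtain ⟨b, e, δ, hδ, hδd, hbd, he, hqe, hfb, hfe⟩ := exists_nearest_boundary_point hΩ hpΩ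
    (fun x hx => (h2 x (hr02 hx)).1)
    (fun x hx y hy => by
      have : 0 ≤ m / 4 * ‖y - x‖ ^ 2 := by positivity
      linarith [hconv x hx y hy])
    (fun x hx => (h2 x (hr02 hx)).2) hqΩ (by linarith)
  have hbr : dist b p < r := by linarith
  have hb0 : b ∈ Metric.ball p r₀ := by rw [Metric.mem_ball]; linarith
  have hb4 : ‖f' b - f' p‖ < τ := h4 b (by rw [Metric.mem_ball]; linarith)
  have hnear : ∀ w, ‖w - b‖ < r → w ∈ Metric.ball p r₀ ∧ w ∈ Metric.ball p r₃ := fun w hw => by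
    have := dist_triangle w b p
    rw [dist_eq_norm w b] at this
    rw [Metric.mem_ball, Metric.mem_ball]
    constructor <;> linarith
  have hb3 : b ∈ Metric.ball p r₃ := by rw [Metric.mem_ball]; linarith
  -- `lam` is the gradient length at `b`; dividing the Taylor expansion by it writes the boundary as
  -- a graph over the normal direction. The form `B / (2 lam)` uses the Hessian at `p`, as the
  -- Taylor remainder is uniform in the base point.
  obtain ⟨lam, hlam⟩ : ∃ lam : ℝ, lam = -f' b e := ⟨_, rfl⟩
  have hfl : ∀ v, f' b v = -(lam * reInner e v) := fun v => by rw [hfe, hlam]; ring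
  have hqb : q - b = δ • e := by rw [hqe]; abel
  have hq0 : q ∈ Metric.ball p r₀ := by rw [Metric.mem_ball]; linarith
  have hee : reInner e e = 1 := by
    rw [reInner_apply, inner_self_eq_norm_sq_to_K, he]; simp
  have hlam0 : 0 < lam := by
    have e1 := hconv b hb0 q hq0
    have e2 := (h2 q (hr02 hq0)).2.1 hqΩ
    rw [hfb, hqb, hfl, map_smul, hee, smul_eq_mul, mul_one] at e1
    have e3 : 0 ≤ m / 4 * ‖δ • e‖ ^ 2 := by positivity
    by_contra! hle
    nlinarith
  have hnorm : ‖f' b‖ = lam := by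
    refine le_antisymm (ContinuousLinearMap.opNorm_le_bound _ hlam0.le fun v => ?_) ?_
    · rw [hfl, norm_neg, norm_mul, Real.norm_of_nonneg hlam0.le, reInner_apply]
      gcongr
      exact (Complex.abs_re_le_norm _).trans (norm_inner_unit_le he v)
    · have := (f' b).le_opNorm e
      rw [he, mul_one, hfl, hee, mul_one, norm_neg, Real.norm_of_nonneg hlam0.le] at this
      exact this
  have hlamΛ : |lam - Λ| < Λ / 2 := by
    rw [← hnorm, hΛ]
    exact ((abs_norm_sub_norm_le _ _).trans_lt hb4).trans_le (min_le_left _ _)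
  obtain ⟨hl1, hl2⟩ := abs_lt.1 hlamΛ
  have hBapp : ∀ v w, ((1 / (2 * lam)) • B) v w = B v w / (2 * lam) := fun v w => by
    simp only [smul_apply, smul_eq_mul]; ring
  have hBn : ‖(1 / (2 * lam)) • B‖ ≤ K := by
    have e1 : ‖B‖ / (2 * lam) ≤ ‖B‖ / Λ := by gcongr; linarith
    have e2 : 0 < m / Λ := by positivity
    refine (ContinuousLinearMap.opNorm_le_bound₂ _ (C := ‖B‖ / (2 * lam)) (by positivity)
      fun v w => ?_).trans (by linarith)
    rw [hBapp, norm_div, Real.norm_of_nonneg (by positivity : (0 : ℝ) ≤ 2 * lam)]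
    calc _ ≤ ‖B‖ * ‖v‖ * ‖w‖ / (2 * lam) := by
          gcongr
          exact B.le_opNorm₂ v w
      _ = _ := by ring
  rw [hqe]
  refine hsq Ω b e ((1 / (2 * lam)) • B) he (fun v w => by rw [hBapp, hBapp, hB]) hBn
    ?_ ?_ ?_ ?_ δ hδ (by linarith)
  · intro v
    rw [hBapp, le_div_iff₀ (by positivity)]
    refine le_trans ?_ (hBm v)
    have e1 : κ * (2 * lam) ≤ m := by
      calc κ * (2 * lam) ≤ m / (6 * Λ) * (2 * (3 / 2 * Λ)) := by gcongr; linarith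
        _ = m / 2 := by field_simp; ring
        _ ≤ m := by linarith
    nlinarith [sq_nonneg ‖v‖]
  · intro w hw
    rw [← reInner_apply]
    by_cases hwr : w ∈ Metric.ball p r₀
    · have e1 := hconv b hb0 w hwr
      have e2 := (h2 w (hr02 hwr)).2.1 hw
      rw [hfb, hfl] at e1
      have e3 : κ * lam ≤ m / 4 := by
        calc κ * lam ≤ m / (6 * Λ) * (3 / 2 * Λ) := by gcongr; linarith
          _ = m / 4 := by field_simp; norm_num
      have e4 : lam * (κ * ‖w - b‖ ^ 2) ≤ lam * reInner e (w - b) := by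
        nlinarith [sq_nonneg ‖w - b‖]
      exact le_of_mul_le_mul_left e4 hlam0
    -- Away from `p` the sphere gives `f' p (w - p) < -r₀²/μ`. Passing to `b` in point and
    -- derivative loses at most a quarter of this each time, by the choice of `d` and `τ`.
    · rw [Metric.mem_ball, not_lt, dist_eq_norm] at hwr
      have e1 := reInner_lt_of_ball hball hsph (x := w - p) (by rwa [add_sub_cancel])
      rw [hgrad] at e1
      have e2 : r₀ ^ 2 ≤ ‖w - p‖ ^ 2 := by gcongr
      have e3 : μ * f' p (w - p) < -r₀ ^ 2 := by linarith
      have e4 : f' p (w - p) < -(r₀ ^ 2 / μ) := by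
        rw [← neg_div, lt_div_iff₀ hμ]; linarith
      have e5 : ‖w - b‖ ≤ 2 * R + 1 := by
        have a1 : dist w c < R := hball hw
        have a2 : dist p c = R := hsph
        have a3 := dist_triangle_right w p c
        have a4 := dist_triangle_right w b p
        rw [← dist_eq_norm]
        linarith
      have e6 : f' b (w - b) = f' p (w - p) - f' p (b - p) + (f' b - f' p) (w - b) := by
        simp only [map_sub, sub_apply]; ring
      have e7 : |f' p (b - p)| ≤ r₀ ^ 2 / (4 * μ) := by
        have a1 := (f' p).le_opNorm (b - p)
        rw [Real.norm_eq_abs, ← dist_eq_norm] at a1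
        refine a1.trans ?_
        calc ‖f' p‖ * dist b p ≤ Λ * (r₀ ^ 2 / (4 * μ * Λ)) := by
              rw [← hΛ]; gcongr; linarith
          _ = _ := by field_simp
      have e8 : |(f' b - f' p) (w - b)| ≤ r₀ ^ 2 / (4 * μ) := by
        have a1 := (f' b - f' p).le_opNorm (w - b)
        rw [Real.norm_eq_abs] at a1
        refine a1.trans ?_
        calc ‖f' b - f' p‖ * ‖w - b‖ ≤ r₀ ^ 2 / (4 * μ * (2 * R + 1)) * (2 * R + 1) := by
              gcongr
              exact hb4.le.trans (min_le_right _ _)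
          _ = _ := by field_simp
      have e9 : lam * reInner e (w - b) = -f' b (w - b) := by rw [hfl]; ring
      have e10 : r₀ ^ 2 / (2 * μ) ≤ lam * reInner e (w - b) := by
        rw [e9, e6]
        have a1 := (abs_le.1 e7).1
        have a2 := (abs_le.1 e8).2
        have a3 : r₀ ^ 2 / μ = 4 * (r₀ ^ 2 / (4 * μ)) := by field_simp
        have a4 : r₀ ^ 2 / (2 * μ) = 2 * (r₀ ^ 2 / (4 * μ)) := by field_simp; norm_num
        linarith
      have e11 : lam * (κ * ‖w - b‖ ^ 2) ≤ r₀ ^ 2 / (2 * μ) := by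
        calc lam * (κ * ‖w - b‖ ^ 2)
            ≤ (2 * Λ) * (r₀ ^ 2 / (4 * μ * Λ * (2 * R + 1) ^ 2) * (2 * R + 1) ^ 2) := by
              gcongr
              · linarith
              · exact min_le_right _ _
          _ = _ := by field_simp; norm_num
      exact le_of_mul_le_mul_left (e11.trans e10) hlam0
  · intro w hw hwr
    obtain ⟨hw0, hw3⟩ := hnear w hwr
    have e1 := (abs_le.1 (h3 b hb3 w hw3)).1
    have e2 := (h2 w (hr02 hw0)).2.1 hw
    rw [hfb, hfl] at e1
    rw [hBapp, ← reInner_apply]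
    have e3 : η * Λ / 4 * ‖w - b‖ ^ 2 ≤ lam * (η * ‖w - b‖ ^ 2) := by
      have : Λ / 4 * (η * ‖w - b‖ ^ 2) ≤ lam * (η * ‖w - b‖ ^ 2) := by gcongr; linarith
      linarith
    have e4 : lam * (B (w - b) (w - b) / (2 * lam)) = B (w - b) (w - b) / 2 := by field_simp
    refine le_of_mul_le_mul_left ?_ hlam0
    rw [mul_sub, e4]
    linarith
  · intro w hwr hw
    obtain ⟨hw0, hw3⟩ := hnear w hwr
    have e1 := (abs_le.1 (h3 b hb3 w hw3)).2
    rw [hfb, hfl] at e1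
    rw [hBapp, ← reInner_apply] at hw
    refine (h2 w (hr02 hw0)).2.2 ?_
    have e3 : η * Λ / 4 * ‖w - b‖ ^ 2 ≤ lam * (η * ‖w - b‖ ^ 2) := by
      have : Λ / 4 * (η * ‖w - b‖ ^ 2) ≤ lam * (η * ‖w - b‖ ^ 2) := by gcongr; linarith
      linarith
    have e4 : lam * (B (w - b) (w - b) / (2 * lam)) = B (w - b) (w - b) / 2 := by field_simp
    have e5 := mul_lt_mul_of_pos_left hw hlam0
    rw [mul_add, e4] at e5
    linarith

end Approach

/-! ### The limit. -/

theorem theorem3p2 {n : ℕ} (Ω : Set (Cn n)) (hΩ : IsDomainIn Ω) (p : Cn n)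
    (hp : IsSphericallyExtreme Ω p) :
    Tendsto (squeezingFunction Ω) (𝓝[Ω] p) (𝓝 1) := by
  obtain ⟨c, R, hR, -, hsph⟩ := hp.2.2
  have hpc : p - c ≠ 0 := by
    intro h
    rw [mem_sphere_iff_norm, h, norm_zero] at hsph
    exact hR.ne hsph
  -- As `R > 0`, the point `p` differs from the centre; this supplies the unit vector needed for the
  -- upper bound `1`.
  have he : ‖(‖p - c‖⁻¹ : ℝ) • (p - c)‖ = 1 := by
    rw [norm_smul, norm_inv, norm_norm, inv_mul_cancel₀ (norm_ne_zero_iff.2 hpc)]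
  refine tendsto_order.2 ⟨fun a ha => ?_, fun a ha => Eventually.of_forall fun q =>
    (squeezingFunction_le_one he Ω q).trans_lt ha⟩
  set ε : ℝ := min ((1 - a) / 2) (1 / 2) with hε
  have hε0 : 0 < ε := by
    have : 0 < 1 - a := by linarith
    positivity
  have hεa : ε ≤ (1 - a) / 2 := min_le_left _ _
  have hε1 : ε < 1 := (min_le_right _ _).trans_lt (by norm_num)
  filter_upwards [eventually_le_squeezingFunction hΩ.1 hp hε0 hε1] with q hq
  linarith
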